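/- Let $\alpha,a,b,h>0$. For $k\in\mathbb R$ put $m_1(k)=1+b|k|+ak^2$ and $m_2(k)=1+bk\coth(hk)+ak^2$ (with the limit value $m_2(0)=1+b/h$), and for $j\in\{1,2\}$ let $A_j$ be the Fourier multiplier $\widehat{A_jf}(k)=-\mathrm i\,\frac{k}{m_j(k)}\,\widehat f(k)$. For $s\ge 0$ let $H^s$ denote either the Sobolev space $H^s(\mathbb R)$ of complex-valued functions, with norm $\|f\|_s^2=\int_{\mathbb R}(1+k^2)^s|\widehat f(k)|^2\,dk$, or the space $H^s_{\mathrm{per}}$ of complex-valued $2\pi$-periodic functions, with norm $\|f\|_s^2=\sum_{k\in\mathbb Z}(1+k^2)^s|\widehat f(k)|^2$; all assertions hold in both settings. For a Banach space $Y$, $T_0>0$ and $F:[-T_0,T_0]\times Y\to Y$, a solution on $[-T,T]$ ($0<T\le T_0$) of $\eta_t=F(t,\eta)$, $\eta(0)=\phi\in Y$, is an $\eta\in C([-T,T];Y)$ with $\eta(0)=\phi$ whose derivative in $Y$ (one-sided at $\pm T$) exists and equals $F(t,\eta(t))$ for every $t\in[-T,T]$. The Cauchy problem is locally well-posed in $Y$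 if $F$ is continuous and: (a) for every $\phi\in Y$ there is a solution on $[-T,T]$ for some $T\in(0,T_0]$; (b) for every $\phi\in Y$ and $T\in(0,T_0]$ there is at most one solution on $[-T,T]$; (c) if $\phi_n\to\phi^*$ in $Y$ and $\eta^*$ is a solution on $[-T^*,T^*]$ with datum $\phi^*$, where $T^*\in(0,T_0]$, then for all large $n$ there are solutions $\eta_n$ on $[-T^*,T^*]$ with data $\phi_n$, and $\sup_{[-T^*,T^*]}\|\eta_n(t)-\eta^*(t)\|_Y\to0$. **Theorem.** Let $s\ge0$, $0\le r\le s+1$, $T_0>0$ and $u\in C([-T_0,T_0];H^s)$. Then $(t,w)\mapsto A_j\big(w-\tfrac{3\alpha}{4}(u(t)w+w^2)\big)$ maps $[-T_0,T_0]\times H^r$ into $H^r$, and the Cauchy problem $$w_t=A_j\Big(w-\frac{3\alpha}{4}\,(uw+w^2)\Big),\qquad w(0)=w_0\in H^r,$$ is locally well-posed in $H^r$. If $u$ and $w_0$ are real-valued, then every solution on an interval $[-T,T]$, $0<T\le T_0$, is real-valued; if moreover $1\le r\le s+1$, then there is a unique solution $w\in C([-T_0,T_0];H^r)$ on the whole interval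 $[-T_0,T_0]$ (so every local solution extends to it). -/

import Mathlib

open MeasureTheory Set Filter Topology
open scoped FourierTransform

/-! ## Well-posedness of a Cauchy problem -/

section WellPosedness

variable {Y : Type*} [NormedAddCommGroup Y] [NormedSpace ℝ Y]

/-- `η ∈ C([-T,T]; Y)` satisfies `η(0) = φ` and `η'(t) = F (t, η t)` for every `t ∈ [-T,T]`; the
derivative is the limit of difference quotients in the norm of `Y`, one-sided at `t = ± T`. -/
structure IsSolutionOn (F : ℝ → Y → Y) (T : ℝ) (φ : Y) (η : ℝ → Y) : Prop where
  continuousOn : ContinuousOn η (Icc (-T) T)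
  initial : η 0 = φ
  hasDeriv : ∀ t ∈ Icc (-T) T, HasDerivWithinAt η (F t (η t)) (Icc (-T) T) t

/-- Local well-posedness in `Y` of `η' = F (t, η)`, `η(0) = φ`, for `F : [-T₀,T₀] × Y → Y`:
`F` is continuous, every datum has a local solution, solutions are unique, and solutions depend
continuously on the datum. -/
structure LocallyWellPosed (T₀ : ℝ) (F : ℝ → Y → Y) : Prop where
  continuousOn : ContinuousOn (fun p : ℝ × Y => F p.1 p.2) (Icc (-T₀) T₀ ×ˢ univ)
  existence : ∀ φ : Y, ∃ T ∈ Ioc 0 T₀, ∃ η : ℝ → Y, IsSolutionOn F T φ η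
  uniqueness : ∀ φ : Y, ∀ T ∈ Ioc 0 T₀, ∀ η₁ η₂ : ℝ → Y,
    IsSolutionOn F T φ η₁ → IsSolutionOn F T φ η₂ → EqOn η₁ η₂ (Icc (-T) T)
  continuous_dependence : ∀ T ∈ Ioc 0 T₀, ∀ (φ : ℕ → Y) (φ' : Y), Tendsto φ atTop (𝓝 φ') →
    ∀ η' : ℝ → Y, IsSolutionOn F T φ' η' →
      ∃ η : ℕ → ℝ → Y, (∀ᶠ n in atTop, IsSolutionOn F T (φ n) (η n)) ∧
        TendstoUniformlyOn η η' atTop (Icc (-T) T)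

end WellPosedness

/-! ## The dispersion symbols -/

/-- The two choices of the operator `𝓛`: the Hilbert transform (`j = 1`), and the Hilbert transform
on the strip of height `h` (`j = 2`). -/
inductive DispersionKind
  | hilbert
  | strip

/-- `m₁(k) = 1 + b|k| + a k²` and `m₂(k) = 1 + b k coth(hk) + a k²`, with the limit value
`m₂(0) = 1 + b / h`. -/
noncomputable def symbolM (j : DispersionKind) (a b h k : ℝ) : ℝ :=
  match j with
  | .hilbert => 1 + b * |k| + a * k ^ 2
  | .strip =>
    if k = 0 then 1 + b / h
    else 1 + b * (k * (Real.cosh (h * k) / Real.sinh (h * k))) + a * k ^ 2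

/-- `φⱼ(k) = k / mⱼ(k)`. The operator `Aⱼ` is the Fourier multiplier with symbol `-i φⱼ(k)`. -/
noncomputable def symbolPhi (j : DispersionKind) (a b h k : ℝ) : ℝ :=
  k / symbolM j a b h k

/-! ## Sobolev spaces on the line

The Fourier transform is Mathlib's, `𝓕 f ξ = ∫ f(x) exp(-2πixξ) dx`; the wave number is `k = 2πξ`,
and `∫ (1+k²)^s |f̂(k)|² dk`, for the transform `f̂(k) = (2π)^(-1/2) ∫ f(x) exp(-ikx) dx`, is equal
to `∫ (1+(2πξ)²)^s |𝓕 f ξ|² dξ`. -/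

/-- `(1+(2πξ)²)^(s/2) 𝓕 f(ξ)`. -/
noncomputable def lineWeighted (s : ℝ) (f : Lp ℂ 2 (volume : Measure ℝ)) (ξ : ℝ) : ℂ :=
  (((1 + (2 * Real.pi * ξ) ^ 2) ^ (s / 2) : ℝ) : ℂ) * (𝓕 f : Lp ℂ 2 (volume : Measure ℝ)) ξ

theorem lineWeighted_add (s : ℝ) (f g : Lp ℂ 2 (volume : Measure ℝ)) :
    lineWeighted s (f + g) =ᵐ[volume] lineWeighted s f + lineWeighted s g := by
  have h : (𝓕 (f + g) : Lp ℂ 2 (volume : Measure ℝ)) = 𝓕 f + 𝓕 g := FourierTransform.fourier_add f g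
  filter_upwards [Lp.coeFn_add (𝓕 f : Lp ℂ 2 (volume : Measure ℝ)) (𝓕 g)] with ξ hξ
  simp only [lineWeighted, Pi.add_apply, h, hξ, mul_add]

theorem lineWeighted_smul (s : ℝ) (c : ℂ) (f : Lp ℂ 2 (volume : Measure ℝ)) :
    lineWeighted s (c • f) =ᵐ[volume] c • lineWeighted s f := by
  have h : (𝓕 (c • f) : Lp ℂ 2 (volume : Measure ℝ)) = c • 𝓕 f :=
    FourierTransform.fourier_smul c f
  filter_upwards [Lp.coeFn_smul c (𝓕 f : Lp ℂ 2 (volume : Measure ℝ))] with ξ hξ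
  simp only [lineWeighted, Pi.smul_apply, h, hξ, smul_eq_mul]
  ring

theorem lineWeighted_zero (s : ℝ) : lineWeighted s 0 =ᵐ[volume] 0 := by
  simpa using lineWeighted_smul s 0 0

/-- The functions `f ∈ L²(ℝ; ℂ)` with `(1+(2πξ)²)^(s/2) 𝓕 f ∈ L²`. -/
noncomputable def lineSobolev (s : ℝ) : Submodule ℂ (Lp ℂ 2 (volume : Measure ℝ)) where
  carrier := {f | MemLp (lineWeighted s f) 2 volume}
  add_mem' {f g} hf hg := (memLp_congr_ae (lineWeighted_add s f g)).2 (MemLp.add hf hg)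
  zero_mem' := (memLp_congr_ae (lineWeighted_zero s)).2 MemLp.zero
  smul_mem' c f hf := (memLp_congr_ae (lineWeighted_smul s c f)).2 (MemLp.const_smul hf c)

/-- The Sobolev space `H^s(ℝ)` for `s ≥ 0`, whose elements are all in `L²(ℝ; ℂ)`. -/
def LineH (s : ℝ) : Type := lineSobolev s

namespace LineH

noncomputable instance (s : ℝ) : AddCommGroup (LineH s) :=
  inferInstanceAs (AddCommGroup (lineSobolev s))

noncomputable instance (s : ℝ) : Module ℂ (LineH s) :=
  inferInstanceAs (Module ℂ (lineSobolev s))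

/-- The underlying `L²` function. -/
noncomputable def toL2 {s : ℝ} : LineH s →ₗ[ℂ] Lp ℂ 2 (volume : Measure ℝ) :=
  (lineSobolev s).subtype

theorem memLp_weighted {s : ℝ} (f : LineH s) : MemLp (lineWeighted s (toL2 f)) 2 volume := f.2

theorem toL2_injective (s : ℝ) : Function.Injective (toL2 (s := s)) := Subtype.val_injective

/-- `f ↦ (1+(2πξ)²)^(s/2) 𝓕 f` as a map into `L²`. -/
noncomputable def weighted {s : ℝ} : LineH s →ₗ[ℂ] Lp ℂ 2 (volume : Measure ℝ) where
  toFun f := MemLp.toLp (lineWeighted s (toL2 f)) (memLp_weighted f)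
  map_add' f g := by
    rw [← MemLp.toLp_add]
    exact MemLp.toLp_congr _ _ (by rw [map_add]; exact lineWeighted_add s (toL2 f) (toL2 g))
  map_smul' c f := by
    rw [RingHom.id_apply, ← MemLp.toLp_const_smul]
    exact MemLp.toLp_congr _ _ (by rw [map_smul]; exact lineWeighted_smul s c (toL2 f))

theorem weighted_injective (s : ℝ) : Function.Injective (weighted (s := s)) := by
  rw [← LinearMap.ker_eq_bot, LinearMap.ker_eq_bot']
  intro f hf
  have h0 : lineWeighted s (toL2 f) =ᵐ[volume] 0 :=
    (MemLp.coeFn_toLp (memLp_weighted f)).symm.trans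
      ((Lp.ext_iff.1 hf).trans (Lp.coeFn_zero ℂ 2 (volume : Measure ℝ)))
  have h1 : (𝓕 (toL2 f) : Lp ℂ 2 (volume : Measure ℝ)) = 0 := by
    refine Lp.ext ?_
    filter_upwards [h0, Lp.coeFn_zero ℂ 2 (volume : Measure ℝ)] with ξ hξ hz
    rw [hz]
    have hp : (0 : ℝ) < (1 + (2 * Real.pi * ξ) ^ 2) ^ (s / 2) := Real.rpow_pos_of_pos (by positivity) _
    exact (mul_eq_zero.1 hξ).resolve_left (by exact_mod_cast hp.ne')
  have h2 : toL2 f = 0 := by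
    rw [← norm_eq_zero, ← Lp.norm_fourier_eq, h1, norm_zero]
  exact toL2_injective s (h2.trans (map_zero _).symm)

/-- The norm is `‖f‖_s = ‖(1+(2πξ)²)^(s/2) 𝓕 f‖_{L²}`. -/
noncomputable instance (s : ℝ) : NormedAddCommGroup (LineH s) :=
  NormedAddCommGroup.induced (LineH s) (Lp ℂ 2 (volume : Measure ℝ)) weighted (weighted_injective s)

noncomputable instance (s : ℝ) : NormedSpace ℂ (LineH s) :=
  NormedSpace.induced ℂ (LineH s) (Lp ℂ 2 (volume : Measure ℝ)) weighted

/-- Real-valued elements. -/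
def IsReal {s : ℝ} (f : LineH s) : Prop := ∀ᵐ x, (toL2 f x).im = 0

/-- `g = Aⱼ(v - (3α/4)(u v + v²))`, on the Fourier side. The products are integrable functions; their
transform is the Fourier integral, and the transform of `v` and `g` is that of `L²`. -/
def IsRHS (j : DispersionKind) (a b h α : ℝ) {s r : ℝ} (u : LineH s) (v g : LineH r) : Prop :=
  ∀ᵐ ξ : ℝ, (𝓕 (toL2 g) : Lp ℂ 2 (volume : Measure ℝ)) ξ =
    -Complex.I * (symbolPhi j a b h (2 * Real.pi * ξ) : ℂ) *
      ((𝓕 (toL2 v) : Lp ℂ 2 (volume : Measure ℝ)) ξ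
        - ((3 * α / 4 : ℝ) : ℂ) * 𝓕 (fun x : ℝ => toL2 u x * toL2 v x + toL2 v x ^ 2) ξ)

end LineH

/-! ## Sobolev spaces of `2π`-periodic functions

The Fourier coefficients are `f̂(k) = (2π)⁻¹ ∫ f(x) exp(-ikx) dx` over a period, `k ∈ ℤ`. -/

instance factZeroLtTwoPi : Fact (0 < 2 * Real.pi) := ⟨Real.two_pi_pos⟩

/-- `L²` of the circle `ℝ / 2πℤ` (with normalized Haar measure). -/
abbrev PerL2 : Type := Lp ℂ 2 (AddCircle.haarAddCircle : Measure (AddCircle (2 * Real.pi)))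

/-- `(1+k²)^(s/2) f̂(k)`. -/
noncomputable def perWeighted (s : ℝ) (f : PerL2) (k : ℤ) : ℂ :=
  (((1 + (k : ℝ) ^ 2) ^ (s / 2) : ℝ) : ℂ) * fourierCoeff f k

theorem perWeighted_add (s : ℝ) (f g : PerL2) :
    perWeighted s (f + g) = perWeighted s f + perWeighted s g := by
  funext k
  simp only [perWeighted, Pi.add_apply, ← fourierBasis_repr, map_add, lp.coeFn_add, mul_add]

theorem perWeighted_smul (s : ℝ) (c : ℂ) (f : PerL2) :
    perWeighted s (c • f) = c • perWeighted s f := by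
  funext k
  simp only [perWeighted, Pi.smul_apply, ← fourierBasis_repr, map_smul, lp.coeFn_smul, smul_eq_mul]
  ring

/-- The functions `f ∈ L²` of the circle with `(1+k²)^(s/2) f̂(k) ∈ ℓ²(ℤ)`. -/
noncomputable def perSobolev (s : ℝ) : Submodule ℂ PerL2 where
  carrier := {f | Memℓp (perWeighted s f) 2}
  add_mem' {f g} hf hg := by
    have := Memℓp.add hf hg
    rwa [← perWeighted_add] at this
  zero_mem' := by
    have h : perWeighted s 0 = 0 := by simpa using perWeighted_smul s 0 0
    change Memℓp (perWeighted s 0) 2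
    rw [h]
    exact zero_memℓp
  smul_mem' c f hf := by
    have := Memℓp.const_smul hf c
    rwa [← perWeighted_smul] at this

/-- The periodic Sobolev space `H^s_per` for `s ≥ 0`, whose elements are all in `L²`. -/
def PerH (s : ℝ) : Type := perSobolev s

namespace PerH

noncomputable instance (s : ℝ) : AddCommGroup (PerH s) :=
  inferInstanceAs (AddCommGroup (perSobolev s))

noncomputable instance (s : ℝ) : Module ℂ (PerH s) :=
  inferInstanceAs (Module ℂ (perSobolev s))

/-- The underlying `L²` function. -/
noncomputable def toL2 {s : ℝ} : PerH s →ₗ[ℂ] PerL2 := (perSobolev s).subtype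

theorem memℓp_weighted {s : ℝ} (f : PerH s) : Memℓp (perWeighted s (toL2 f)) 2 := f.2

theorem toL2_injective (s : ℝ) : Function.Injective (toL2 (s := s)) := Subtype.val_injective

/-- `f ↦ (1+k²)^(s/2) f̂(k)` as a map into `ℓ²(ℤ)`. -/
noncomputable def weighted {s : ℝ} : PerH s →ₗ[ℂ] lp (fun _ : ℤ => ℂ) 2 where
  toFun f := ⟨perWeighted s (toL2 f), memℓp_weighted f⟩
  map_add' f g := Subtype.ext
    ((congrArg (perWeighted s) (map_add toL2 f g)).trans (perWeighted_add s (toL2 f) (toL2 g)))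
  map_smul' c f := Subtype.ext
    ((congrArg (perWeighted s) (map_smul toL2 c f)).trans (perWeighted_smul s c (toL2 f)))

theorem weighted_injective (s : ℝ) : Function.Injective (weighted (s := s)) := by
  rw [← LinearMap.ker_eq_bot, LinearMap.ker_eq_bot']
  intro f hf
  have h0 : perWeighted s (toL2 f) = 0 := congrArg Subtype.val hf
  have h2 : toL2 f = 0 := by
    apply fourierBasis.repr.injective
    rw [map_zero]
    ext k
    have hp : (0 : ℝ) < (1 + (k : ℝ) ^ 2) ^ (s / 2) := Real.rpow_pos_of_pos (by positivity) _
    rw [fourierBasis_repr]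
    exact (mul_eq_zero.1 (congrFun h0 k)).resolve_left (by exact_mod_cast hp.ne')
  exact toL2_injective s (h2.trans (map_zero _).symm)

/-- The norm is `‖f‖_s = (∑ (1+k²)^s |f̂(k)|²)^(1/2)`. -/
noncomputable instance (s : ℝ) : NormedAddCommGroup (PerH s) :=
  NormedAddCommGroup.induced (PerH s) (lp (fun _ : ℤ => ℂ) 2) weighted (weighted_injective s)

noncomputable instance (s : ℝ) : NormedSpace ℂ (PerH s) :=
  NormedSpace.induced ℂ (PerH s) (lp (fun _ : ℤ => ℂ) 2) weighted

/-- Real-valued elements. -/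
def IsReal {s : ℝ} (f : PerH s) : Prop :=
  ∀ᵐ x ∂(AddCircle.haarAddCircle : Measure (AddCircle (2 * Real.pi))), (toL2 f x).im = 0

/-- `g = Aⱼ(v - (3α/4)(u v + v²))`, in terms of the Fourier coefficients. -/
def IsRHS (j : DispersionKind) (a b h α : ℝ) {s r : ℝ} (u : PerH s) (v g : PerH r) : Prop :=
  ∀ k : ℤ, fourierCoeff (toL2 g) k =
    -Complex.I * (symbolPhi j a b h (k : ℝ) : ℂ) *
      fourierCoeff (fun x => toL2 v x
        - ((3 * α / 4 : ℝ) : ℂ) * (toL2 u x * toL2 v x + toL2 v x ^ 2)) k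

end PerH

/-! The symbols satisfy `c (1 + k²) ≤ m(k) ≤ C (1 + k²)`, so `Aⱼ` gains one derivative and the
equation is an ordinary differential equation in `H^r` rather than a genuine PDE. Everything is done
on weighted transforms `W = (1 + κ²)^(r/2) ŵ`, which range over `L²(μ)`, with `μ` Lebesgue measure
for the line and counting measure on `ℤ` for the circle. Both settings thus become one abstract
problem on a `FrequencySpace`, where products are convolutions.

Local theory. The point is `‖Aⱼ(u v)‖_r ≤ C ‖u‖_s ‖v‖_r` for `0 ≤ r ≤ s + 1`. By
`sobolevWeight_kernel_le` the kernel of this weighted convolution is at most `C (w(k) + w(l))`,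
where `k` is the output frequency, `l` that of `v`, and `w = (1 + κ²)^(-1/2)`. As frequencies are
one-dimensional, `w ∈ L²(μ)`, and Cauchy–Schwarz and Young finish (`eLpNorm_mul_fourierConv_le`).
The field is then a continuous quadratic polynomial in `W`, hence locally Lipschitz, and
Cauchy–Lipschitz theory applies (`IsLocallyLipschitzField.locallyWellPosed`).

Reality. Conjugation acts as `W ↦ conj W(-·)` and commutes with the field when `u` is real, because
`m` is even. Uniqueness then keeps real data real.

Global theory, `r ≥ 1`. The energy `∫ m |ŵ|²` is comparable to `‖w‖₁²`. In its derivative `m`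
cancels; the linear term has no real part, the cubic term is a multiple of `∫ w² w_x = 0`, and the
term with `u` is at most `C ‖u‖₀ ‖w‖₁²` (`exists_re_inner_energy_le`). Grönwall bounds the energy on
`[-T₀, T₀]`. The tame estimate `‖Aⱼ(w²)‖_r ≤ C ‖w‖₁ ‖w‖_r` (`exists_norm_bilin_self_le`) makes the
field grow linearly along the solution, so a second Grönwall argument bounds `‖w‖_r`, and
`IsLocallyLipschitzField.exists_global` continues the solution to `[-T₀, T₀]`. -/

/-! ## Ordinary differential equations in a Banach space -/

section ODE

variable {Y : Type*} [NormedAddCommGroup Y] [NormedSpace ℝ Y]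

/-- Grönwall's inequality on both sides of the initial time. -/
theorem norm_le_exp_of_norm_deriv_le {f f' : ℝ → Y} {K T : ℝ} (hT : 0 ≤ T) (hK : 0 ≤ K)
    (hf : ∀ t ∈ Icc (-T) T, HasDerivWithinAt f (f' t) (Icc (-T) T) t)
    (bound : ∀ t ∈ Icc (-T) T, ‖f' t‖ ≤ K * ‖f t‖) :
    ∀ t ∈ Icc (-T) T, ‖f t‖ ≤ ‖f 0‖ * Real.exp (K * T) := by
  -- Stated for arbitrary `g` so that negative times follow by applying it to `fun x => f (-x)`.
  have forward : ∀ g g' : ℝ → Y,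
      (∀ t ∈ Icc (-T) T, HasDerivWithinAt g (g' t) (Icc (-T) T) t) →
      (∀ t ∈ Icc (-T) T, ‖g' t‖ ≤ K * ‖g t‖) →
      ∀ t ∈ Icc 0 T, ‖g t‖ ≤ ‖g 0‖ * Real.exp (K * T) := by
    intro g g' hg hb t ht
    have hsub : Icc 0 T ⊆ Icc (-T) T := Icc_subset_Icc_left (by linarith)
    have h := norm_le_gronwallBound_of_norm_deriv_right_le (f := g) (f' := g') (δ := ‖g 0‖)
      (K := K) (ε := 0) (a := 0) (b := T)
      (fun x hx => ((hg x (hsub hx)).mono hsub).continuousWithinAt)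
      (fun x hx => (hg x (hsub ⟨hx.1, hx.2.le⟩)).mono_of_mem_nhdsWithin
        (mem_of_superset (Icc_mem_nhdsGE hx.2) (Icc_subset_Icc_left (by linarith [hx.1]))))
      le_rfl (fun x hx => by simpa using hb x (hsub ⟨hx.1, hx.2.le⟩)) t ht
    rw [gronwallBound_ε0] at h
    refine h.trans (mul_le_mul_of_nonneg_left (Real.exp_le_exp.2 ?_) (norm_nonneg _))
    exact mul_le_mul_of_nonneg_left (by linarith [ht.2]) hK
  intro t ht
  rcases le_total 0 t with h0 | h0
  · exact forward f f' hf bound t ⟨h0, ht.2⟩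
  · have hmem : ∀ x ∈ Icc (-T) T, -x ∈ Icc (-T) T := fun x hx => ⟨by linarith [hx.2], by linarith [hx.1]⟩
    have := forward (fun x => f (-x)) (fun x => -f' (-x)) (fun x hx => by
      have h1 := (hf (-x) (hmem x hx)).scomp (h := fun y : ℝ => -y) x
        (hasDerivAt_neg x).hasDerivWithinAt (fun y hy => hmem y hy)
      simpa [Function.comp_def] using h1)
      (fun x hx => by simpa using bound (-x) (hmem x hx)) (-t) ⟨by linarith, by linarith [ht.1]⟩
    simpa using this

variable {F G : ℝ → Y → Y} {T T₀ R : ℝ} {φ : Y} {η : ℝ → Y}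

/-- Agreement along the trajectory suffices; this is how solutions pass between a field and its
truncation. -/
theorem IsSolutionOn.congr_field (h : IsSolutionOn F T φ η)
    (hFG : ∀ t ∈ Icc (-T) T, F t (η t) = G t (η t)) : IsSolutionOn G T φ η :=
  ⟨h.continuousOn, h.initial, fun t ht => hFG t ht ▸ h.hasDeriv t ht⟩

theorem IsSolutionOn.mono {T' : ℝ} (h : IsSolutionOn F T φ η) (hT : T' ≤ T) :
    IsSolutionOn F T' φ η :=
  have hsub : Icc (-T') T' ⊆ Icc (-T) T := Icc_subset_Icc (by linarith) hT
  ⟨h.continuousOn.mono hsub, h.initial, fun t ht => (h.hasDeriv t (hsub ht)).mono hsub⟩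

/-- Used for the isometry to the Fourier side and for conjugation, which is only real-linear. -/
theorem IsSolutionOn.map {Z : Type*} [NormedAddCommGroup Z] [NormedSpace ℝ Z] {G : ℝ → Z → Z}
    (L : Y →L[ℝ] Z) (h : IsSolutionOn F T φ η)
    (hL : ∀ t ∈ Icc (-T) T, L (F t (η t)) = G t (L (η t))) :
    IsSolutionOn G T (L φ) (fun t => L (η t)) :=
  ⟨L.continuous.comp_continuousOn h.continuousOn, by rw [h.initial],
    fun t ht => hL t ht ▸ L.hasFDerivAt.comp_hasDerivWithinAt t (h.hasDeriv t ht)⟩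

theorem IsSolutionOn.exists_norm_le (h : IsSolutionOn F T φ η) :
    ∃ R, ∀ t ∈ Icc (-T) T, ‖η t‖ ≤ R :=
  isCompact_Icc.exists_bound_of_continuousOn h.continuousOn

/-- Two solutions of a Lipschitz equation stay close. -/
theorem IsSolutionOn.norm_sub_le {K : NNReal} {S : Set Y} {φ₁ φ₂ : Y} {η₁ η₂ : ℝ → Y}
    (hT : 0 ≤ T) (h₁ : IsSolutionOn F T φ₁ η₁) (h₂ : IsSolutionOn F T φ₂ η₂)
    (hF : ∀ t ∈ Icc (-T) T, LipschitzOnWith K (F t) S)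
    (hS₁ : ∀ t ∈ Icc (-T) T, η₁ t ∈ S) (hS₂ : ∀ t ∈ Icc (-T) T, η₂ t ∈ S) :
    ∀ t ∈ Icc (-T) T, ‖η₁ t - η₂ t‖ ≤ ‖φ₁ - φ₂‖ * Real.exp (K * T) := by
  intro t ht
  have := norm_le_exp_of_norm_deriv_le (f := fun t => η₁ t - η₂ t) hT K.2
    (fun t ht => (h₁.hasDeriv t ht).sub (h₂.hasDeriv t ht))
    (fun t ht => (hF t ht).norm_sub_le (hS₁ t ht) (hS₂ t ht)) t ht
  simpa [h₁.initial, h₂.initial] using this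

/-- Hypotheses of the Cauchy–Lipschitz theory on `[-T₀, T₀]`. -/
structure IsLocallyLipschitzField (T₀ : ℝ) (F : ℝ → Y → Y) : Prop where
  continuousOn : ContinuousOn (fun p : ℝ × Y => F p.1 p.2) (Icc (-T₀) T₀ ×ˢ univ)
  lipschitz : ∀ R : ℝ, ∃ K : NNReal, ∀ t ∈ Icc (-T₀) T₀,
    LipschitzOnWith K (F t) (Metric.closedBall 0 R)

/-- A bounded and globally Lipschitz field on `[-T₀, T₀]`. -/
structure IsBoundedLipschitzField (T₀ : ℝ) (F : ℝ → Y → Y) (K L : NNReal) : Prop where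
  continuousOn : ∀ x, ContinuousOn (fun t => F t x) (Icc (-T₀) T₀)
  lipschitz : ∀ t ∈ Icc (-T₀) T₀, LipschitzWith K (F t)
  norm_le : ∀ t ∈ Icc (-T₀) T₀, ∀ x, ‖F t x‖ ≤ L

theorem IsLocallyLipschitzField.exists_norm_le (hF : IsLocallyLipschitzField T₀ F) (R : ℝ) :
    ∃ M : NNReal, ∀ t ∈ Icc (-T₀) T₀, ∀ x, ‖x‖ ≤ R → ‖F t x‖ ≤ M := by
  obtain ⟨K, hK⟩ := hF.lipschitz R
  have hc : ContinuousOn (fun t => F t 0) (Icc (-T₀) T₀) :=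
    hF.continuousOn.comp (f := fun t : ℝ => (t, (0 : Y))) (by fun_prop) (fun t ht => ⟨ht, mem_univ _⟩)
  obtain ⟨C, hC⟩ := isCompact_Icc.exists_bound_of_continuousOn hc
  refine ⟨(C + K * R).toNNReal, fun t ht x hx => le_trans ?_ (Real.le_coe_toNNReal _)⟩
  have h0 : (0 : Y) ∈ Metric.closedBall (0 : Y) R :=
    Metric.mem_closedBall_self ((norm_nonneg x).trans hx)
  have h1 := (hK t ht).norm_sub_le (x := x) (by simpa using hx) h0
  rw [sub_zero] at h1
  calc ‖F t x‖ = ‖F t 0 + (F t x - F t 0)‖ := by rw [add_sub_cancel]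
    _ ≤ ‖F t 0‖ + ‖F t x - F t 0‖ := norm_add_le _ _
    _ ≤ C + K * R := by
      have h2 : (K : ℝ) * ‖x‖ ≤ K * R := mul_le_mul_of_nonneg_left hx K.2
      linarith [hC t ht]

/-- A locally Lipschitz field coincides on a given ball with a bounded and Lipschitz one. -/
theorem IsLocallyLipschitzField.exists_truncation (hF : IsLocallyLipschitzField T₀ F) (R : ℝ) :
    ∃ (G : ℝ → Y → Y) (K L : NNReal), IsBoundedLipschitzField T₀ G K L ∧
      ∀ t x, ‖x‖ ≤ R → G t x = F t x := by
  obtain ⟨K, hK⟩ := hF.lipschitz (R + 1)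
  obtain ⟨M, hM⟩ := hF.exists_norm_le (R + 1)
  -- A 1-Lipschitz cutoff, equal to 1 on the ball of radius `R` and to 0 outside that of radius `R +
  -- 1`. The product rule gives `χ F` the Lipschitz constant `K + M`.
  set χ : Y → ℝ := fun x => max 0 (min 1 (R + 1 - ‖x‖)) with hχ
  have hχ0 : ∀ x, 0 ≤ χ x := fun x => le_max_left _ _
  have hχ1 : ∀ x, χ x ≤ 1 := fun x => max_le zero_le_one (min_le_left _ _)
  have hχout : ∀ x, R + 1 ≤ ‖x‖ → χ x = 0 := fun x hx =>
    max_eq_left ((min_le_right _ _).trans (by linarith))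
  have hχlip : ∀ x y, |χ x - χ y| ≤ ‖x - y‖ := by
    intro x y
    have h1 : |χ x - χ y| ≤ |min 1 (R + 1 - ‖x‖) - min 1 (R + 1 - ‖y‖)| :=
      by
        simpa only [hχ, max_comm (0 : ℝ)] using abs_max_sub_max_le_abs
          (min 1 (R + 1 - ‖x‖)) (min 1 (R + 1 - ‖y‖)) 0
    have h2 : |min 1 (R + 1 - ‖x‖) - min 1 (R + 1 - ‖y‖)| ≤ |(R + 1 - ‖x‖) - (R + 1 - ‖y‖)| := by
      have := abs_min_sub_min_le_max 1 (R + 1 - ‖x‖) 1 (R + 1 - ‖y‖)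
      simpa using this
    have h3 : |(R + 1 - ‖x‖) - (R + 1 - ‖y‖)| = |‖y‖ - ‖x‖| := by congr 1; ring
    rw [h3] at h2
    exact (h1.trans h2).trans ((abs_norm_sub_norm_le y x).trans_eq (norm_sub_rev y x))
  have bound : ∀ t ∈ Icc (-T₀) T₀, ∀ x, ‖χ x • F t x‖ ≤ χ x * M := by
    intro t ht x
    rw [norm_smul, Real.norm_of_nonneg (hχ0 x)]
    rcases le_total ‖x‖ (R + 1) with hx | hx
    · exact mul_le_mul_of_nonneg_left (hM t ht x hx) (hχ0 x)
    · simp [hχout x hx]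
  refine ⟨fun t x => χ x • F t x, K + M, M, ⟨fun x => ?_, fun t ht => ?_, fun t ht x => ?_⟩, ?_⟩
  · exact (hF.continuousOn.comp (f := fun t : ℝ => (t, x)) (by fun_prop)
      (fun t ht => ⟨ht, mem_univ _⟩)).const_smul (χ x)
  -- Outside the larger ball nothing is known about `F`, but there `χ y = 0` and `χ x = χ x - χ y ≤
  -- ‖x - y‖`.
  · have out : ∀ x y, R + 1 ≤ ‖y‖ → ‖χ x • F t x - χ y • F t y‖ ≤ (K + M) * ‖x - y‖ := by
      intro x y hy
      rw [hχout y hy, zero_smul, sub_zero]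
      refine (bound t ht x).trans ?_
      have := hχlip x y
      rw [hχout y hy, sub_zero, abs_of_nonneg (hχ0 x)] at this
      have h1 := mul_le_mul_of_nonneg_right this M.2
      have h2 : 0 ≤ (K : ℝ) * ‖x - y‖ := mul_nonneg K.2 (norm_nonneg _)
      change χ x * (M : ℝ) ≤ ‖x - y‖ * M at h1
      linarith [h1, h2]
    refine LipschitzWith.of_dist_le_mul fun x y => ?_
    rw [dist_eq_norm, dist_eq_norm, NNReal.coe_add]
    rcases le_total (R + 1) ‖y‖ with hy | hy
    · exact out x y hy
    rcases le_total (R + 1) ‖x‖ with hx | hx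
    · rw [norm_sub_rev, norm_sub_rev x]
      exact out y x hx
    have e : χ x • F t x - χ y • F t y = χ x • (F t x - F t y) + (χ x - χ y) • F t y := by
      rw [smul_sub, sub_smul]; abel
    rw [e]
    refine (norm_add_le _ _).trans ?_
    rw [norm_smul, norm_smul, Real.norm_of_nonneg (hχ0 x), Real.norm_eq_abs]
    have h1 : ‖F t x - F t y‖ ≤ K * ‖x - y‖ :=
      (hK t ht).norm_sub_le (by simpa using hx) (by simpa using hy)
    have h2 : χ x * ‖F t x - F t y‖ ≤ 1 * ‖F t x - F t y‖ :=
      mul_le_mul_of_nonneg_right (hχ1 x) (norm_nonneg _)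
    have h3 : |χ x - χ y| * ‖F t y‖ ≤ ‖x - y‖ * M :=
      mul_le_mul (hχlip x y) (hM t ht y hy) (norm_nonneg _) (norm_nonneg _)
    linarith
  · exact (bound t ht x).trans (mul_le_of_le_one_left M.2 (hχ1 x))
  · intro t x hx
    have : χ x = 1 := by
      simp only [hχ]
      rw [min_eq_left (by linarith), max_eq_right zero_le_one]
    simp [this]

/-- A bounded and Lipschitz field has global solutions. -/
theorem IsBoundedLipschitzField.exists_isSolutionOn [CompleteSpace Y] {K L : NNReal}
    (hF : IsBoundedLipschitzField T₀ F K L) (hT : T ∈ Ioc 0 T₀) (φ : Y) :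
    ∃ η, IsSolutionOn F T φ η := by
  have hsub : Icc (-T) T ⊆ Icc (-T₀) T₀ := Icc_subset_Icc (by linarith [hT.2]) hT.2
  have h0 : (0 : ℝ) ∈ Icc (-T) T := ⟨by linarith [hT.1], hT.1.le⟩
  -- The bounds hold on all of `Y`, so the radius can be taken as large as `L T`, the farthest a
  -- solution can travel, and `T` need not be small.
  have hPL : IsPicardLindelof F (tmin := -T) (tmax := T) ⟨0, h0⟩ φ (L * T.toNNReal) 0 L K :=
    { lipschitzOnWith := fun t ht => (hF.lipschitz t (hsub ht)).lipschitzOnWith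
      continuousOn := fun x _ => (hF.continuousOn x).mono hsub
      norm_le := fun t ht x _ => hF.norm_le t (hsub ht) x
      mul_max_le := by simp [hT.1.le] }
  obtain ⟨η, hη0, hη⟩ := hPL.exists_eq_forall_mem_Icc_hasDerivWithinAt₀
  exact ⟨η, fun t ht => (hη t ht).continuousWithinAt, hη0, hη⟩

/-- Both trajectories are bounded, so one ball and one Lipschitz constant serve for both; Grönwall
with zero initial distance concludes. -/
theorem IsLocallyLipschitzField.eqOn (hF : IsLocallyLipschitzField T₀ F) (hT : T ∈ Ioc 0 T₀)
    {η₁ η₂ : ℝ → Y} (h₁ : IsSolutionOn F T φ η₁) (h₂ : IsSolutionOn F T φ η₂) :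
    EqOn η₁ η₂ (Icc (-T) T) := by
  have hsub : Icc (-T) T ⊆ Icc (-T₀) T₀ := Icc_subset_Icc (by linarith [hT.2]) hT.2
  obtain ⟨R₁, hR₁⟩ := h₁.exists_norm_le
  obtain ⟨R₂, hR₂⟩ := h₂.exists_norm_le
  obtain ⟨K, hK⟩ := hF.lipschitz (max R₁ R₂)
  intro t ht
  have := h₁.norm_sub_le hT.1.le h₂ (fun t ht => hK t (hsub ht))
    (fun t ht => by simpa using Or.inl (hR₁ t ht)) (fun t ht => by simpa using Or.inr (hR₂ t ht)) t ht
  rw [sub_self, norm_zero, zero_mul] at this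
  exact sub_eq_zero.1 (norm_le_zero_iff.1 this)

/-- Solutions of the truncated equation that stay in the ball are solutions. -/
theorem IsLocallyLipschitzField.locallyWellPosed [CompleteSpace Y] (hT₀ : 0 < T₀)
    (hF : IsLocallyLipschitzField T₀ F) : LocallyWellPosed T₀ F where
  continuousOn := hF.continuousOn
  existence φ := by
    obtain ⟨G, K, L, hG, hGF⟩ := hF.exists_truncation (‖φ‖ + 1)
    obtain ⟨η, hη⟩ := hG.exists_isSolutionOn ⟨hT₀, le_rfl⟩ φ
    have hc : ContinuousAt η 0 := hη.continuousOn.continuousAt (Icc_mem_nhds (by linarith) hT₀)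
    have hev : ∀ᶠ t in 𝓝 (0 : ℝ), ‖η t‖ < ‖φ‖ + 1 :=
      hc.norm.eventually_lt continuousAt_const (by simp [hη.initial])
    obtain ⟨δ, hδ, hball⟩ := Metric.eventually_nhds_iff.1 hev
    have hT : min (δ / 2) T₀ ∈ Ioc 0 T₀ := ⟨lt_min (by linarith) hT₀, min_le_right _ _⟩
    refine ⟨min (δ / 2) T₀, hT, η, (hη.mono hT.2).congr_field fun t ht => hGF t _ (hball ?_).le⟩
    rw [Real.dist_0_eq_abs]
    exact (abs_le.2 ht).trans_lt ((min_le_left _ _).trans_lt (by linarith))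
  uniqueness φ T hT η₁ η₂ h₁ h₂ := hF.eqOn hT h₁ h₂
  continuous_dependence T hT φ φ' hφ η' hη' := by
    have hsub : Icc (-T) T ⊆ Icc (-T₀) T₀ := Icc_subset_Icc (by linarith [hT.2]) hT.2
    obtain ⟨R, hR⟩ := hη'.exists_norm_le
    -- The margin 1 leaves room for the perturbed solutions: once they are within distance 1 of
    -- `η'`, the truncation is not felt.
    obtain ⟨G, K, L, hG, hGF⟩ := hF.exists_truncation (R + 1)
    choose η hη using fun n => hG.exists_isSolutionOn hT (φ n)
    have hη'G : IsSolutionOn G T φ' η' :=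
      hη'.congr_field fun t ht => (hGF t _ ((hR t ht).trans (by linarith))).symm
    have hdist : ∀ n, ∀ t ∈ Icc (-T) T, ‖η n t - η' t‖ ≤ ‖φ n - φ'‖ * Real.exp (K * T) := fun n =>
      (hη n).norm_sub_le hT.1.le hη'G (fun t ht => (hG.lipschitz t (hsub ht)).lipschitzOnWith)
        (fun _ _ => mem_univ _) (fun _ _ => mem_univ _)
    have hlim : Tendsto (fun n => ‖φ n - φ'‖ * Real.exp (K * T)) atTop (𝓝 0) := by
      simpa using (tendsto_iff_norm_sub_tendsto_zero.1 hφ).mul_const (Real.exp (K * T))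
    refine ⟨η, ?_, Metric.tendstoUniformlyOn_iff.2 fun ε hε => ?_⟩
    · filter_upwards [hlim.eventually_lt_const one_pos] with n hn
      refine (hη n).congr_field fun t ht => hGF t _ ?_
      have h1 := norm_le_norm_add_norm_sub (η' t) (η n t)
      rw [norm_sub_rev] at h1
      have h2 := hdist n t ht
      have h3 := hR t ht
      linarith
    · filter_upwards [hlim.eventually_lt_const hε] with n hn t ht
      rw [dist_comm, dist_eq_norm]
      exact (hdist n t ht).trans_lt hn

/-- An a priori bound gives a solution on the whole interval. -/
theorem IsLocallyLipschitzField.exists_global [CompleteSpace Y] (hT₀ : 0 < T₀)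
    (hF : IsLocallyLipschitzField T₀ F) (φ : Y) (R : ℝ) (hφ : ‖φ‖ ≤ R)
    (apriori : ∀ T ∈ Ioc 0 T₀, ∀ η, IsSolutionOn F T φ η → ∀ t ∈ Icc (-T) T, ‖η t‖ ≤ R) :
    ∃ η, IsSolutionOn F T₀ φ η := by
  obtain ⟨G, K, L, hG, hGF⟩ := hF.exists_truncation (R + 1)
  obtain ⟨η, hη⟩ := hG.exists_isSolutionOn ⟨hT₀, le_rfl⟩ φ
  have hmem : ∀ {t x : ℝ}, t ∈ Icc 0 T₀ → |x| ≤ t → x ∈ Icc (-T₀) T₀ := fun ht hx =>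
    abs_le.1 (hx.trans ht.2)
  -- Continuation argument, symmetric in time because solutions live on `[-t, t]`: `S` is closed in
  -- `[0, T₀]`, contains 0, and extends to the right of any `t` with `[0, t] ⊆ S`.
  set S : Set ℝ := {t | ‖η t‖ ≤ R ∧ ‖η (-t)‖ ≤ R}
  have hneg : ContinuousOn (fun t => η (-t)) (Icc 0 T₀) :=
    hη.continuousOn.comp continuous_neg.continuousOn fun t ht =>
      hmem ht (by rw [abs_neg, abs_of_nonneg ht.1])
  have hpos : ContinuousOn η (Icc 0 T₀) := hη.continuousOn.mono (Icc_subset_Icc_left (by linarith))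
  have hS : Icc 0 T₀ ⊆ S := by
    refine IsClosed.Icc_subset_of_forall_mem_nhdsGT_of_Icc_subset ?_ (by simp [S, hη.initial, hφ]) ?_
    · have h1 := hpos.norm.preimage_isClosed_of_isClosed isClosed_Icc (isClosed_Iic (a := R))
      have h2 := hneg.norm.preimage_isClosed_of_isClosed isClosed_Icc (isClosed_Iic (a := R))
      convert h1.inter h2 using 1
      ext t
      simp only [S, mem_inter_iff, mem_ofPred_eq, mem_preimage, mem_Iic]
      tauto
    · intro t ht hIcc
      have hlt : ∀ g : ℝ → Y, ContinuousOn g (Icc 0 T₀) → ‖g t‖ ≤ R →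
          ∀ᶠ x in 𝓝[>] t, ‖g x‖ < R + 1 := by
        intro g hg hgt
        have h1 : Tendsto (fun x => ‖g x‖) (𝓝[>] t) (𝓝 ‖g t‖) := by
          refine ((hg t ⟨ht.1, ht.2.le⟩).norm).mono_left (nhdsWithin_le_of_mem ?_)
          exact mem_of_superset (Ioc_mem_nhdsGT ht.2) fun x hx => ⟨ht.1.trans hx.1.le, hx.2⟩
        exact h1.eventually_lt_const (by linarith)
      have htS := hIcc (right_mem_Icc.2 ht.1)
      obtain ⟨c, hc, hIoo⟩ := (mem_nhdsGT_iff_exists_Ioo_subset).1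
        ((hlt η hpos htS.1).and ((hlt _ hneg htS.2).and (Ioo_mem_nhdsGT ht.2)))
      refine mem_of_superset (Ioo_mem_nhdsGT hc) fun x hx => ?_
      have hx0 : 0 < x := ht.1.trans_lt hx.1
      have hxT : x ≤ T₀ := (hIoo hx).2.2.2.le
      -- Just after `t` the norm is still below `R + 1`, so `η` solves the untruncated equation
      -- there, and the a priori bound improves `R + 1` back to `R`.
      have hsol : IsSolutionOn F x φ η := by
        refine (hη.mono hxT).congr_field fun y hy => hGF y _ ?_
        have key : ∀ z, 0 ≤ z → z ≤ x → ‖η z‖ ≤ R + 1 ∧ ‖η (-z)‖ ≤ R + 1 := by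
          intro z hz hzx
          rcases le_or_gt z t with h | h
          · have := hIcc ⟨hz, h⟩
            exact ⟨this.1.trans (by linarith), this.2.trans (by linarith)⟩
          · have := hIoo ⟨h, hzx.trans_lt hx.2⟩
            exact ⟨this.1.le, this.2.1.le⟩
        rcases le_total 0 y with h | h
        · exact (key y h hy.2).1
        · simpa using (key (-y) (by linarith) (by linarith [hy.1])).2
      exact ⟨apriori x ⟨hx0, hxT⟩ η hsol x ⟨by linarith, le_rfl⟩,
        apriori x ⟨hx0, hxT⟩ η hsol (-x) ⟨le_rfl, by linarith⟩⟩
  refine ⟨η, hη.congr_field fun t ht => hGF t _ ?_⟩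
  rcases le_total 0 t with h | h
  · exact (hS ⟨h, ht.2⟩).1.trans (by linarith)
  · have := (@hS (-t) ⟨by linarith, by linarith [ht.1]⟩).2
    rw [neg_neg] at this
    linarith

end ODE

/-! ## Polynomial weights -/

/-- The weight `(1 + κ²)^(s/2)`. -/
noncomputable def sobolevWeight (s κ : ℝ) : ℝ := (1 + κ ^ 2) ^ (s / 2)

section Weight

variable {s t κ : ℝ}

theorem one_le_one_add_sq (κ : ℝ) : 1 ≤ 1 + κ ^ 2 := by nlinarith [sq_nonneg κ]

theorem sobolevWeight_pos (s κ : ℝ) : 0 < sobolevWeight s κ :=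
  Real.rpow_pos_of_pos (zero_lt_one.trans_le (one_le_one_add_sq κ)) _

theorem sobolevWeight_zero (κ : ℝ) : sobolevWeight 0 κ = 1 := by simp [sobolevWeight]

theorem sobolevWeight_two (κ : ℝ) : sobolevWeight 2 κ = 1 + κ ^ 2 := by simp [sobolevWeight]

theorem sobolevWeight_add (s t κ : ℝ) :
    sobolevWeight (s + t) κ = sobolevWeight s κ * sobolevWeight t κ := by
  rw [sobolevWeight, add_div, Real.rpow_add (zero_lt_one.trans_le (one_le_one_add_sq κ))]
  rfl

theorem sobolevWeight_mono (h : s ≤ t) (κ : ℝ) : sobolevWeight s κ ≤ sobolevWeight t κ :=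
  Real.rpow_le_rpow_of_exponent_le (one_le_one_add_sq κ) (by linarith)

theorem sobolevWeight_le_one (h : s ≤ 0) (κ : ℝ) : sobolevWeight s κ ≤ 1 :=
  (sobolevWeight_mono h κ).trans_eq (sobolevWeight_zero κ)

theorem sobolevWeight_neg_arg (s κ : ℝ) : sobolevWeight s (-κ) = sobolevWeight s κ := by
  simp [sobolevWeight]

theorem abs_le_sobolevWeight_one (κ : ℝ) : |κ| ≤ sobolevWeight 1 κ := by
  rw [sobolevWeight, ← Real.sqrt_eq_rpow]
  exact Real.abs_le_sqrt (by linarith)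

theorem continuous_sobolevWeight (s : ℝ) : Continuous (sobolevWeight s) :=
  Continuous.rpow_const (by fun_prop) fun x => Or.inl (zero_lt_one.trans_le (one_le_one_add_sq x)).ne'

/-- Peetre's inequality. -/
theorem sobolevWeight_add_arg_le (hs : 0 ≤ s) (x y : ℝ) :
    sobolevWeight s (x + y) ≤ 2 ^ s * (sobolevWeight s x + sobolevWeight s y) := by
  -- The larger frequency dominates: `1 + (x + y)² ≤ 4 (1 + y²)`, raised to the power `s / 2`.
  have key : ∀ x y : ℝ, x ^ 2 ≤ y ^ 2 → sobolevWeight s (x + y) ≤ 2 ^ s * sobolevWeight s y := by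
    intro x y h
    have h2 : (2 : ℝ) ^ s = (4 : ℝ) ^ (s / 2) := by
      rw [show (4 : ℝ) = 2 ^ (2 : ℝ) by norm_num, ← Real.rpow_mul (by norm_num)]
      congr 1; ring
    rw [h2, sobolevWeight, sobolevWeight,
      ← Real.mul_rpow (by norm_num) (zero_le_one.trans (one_le_one_add_sq y))]
    refine Real.rpow_le_rpow (by positivity) ?_ (by linarith)
    nlinarith [sq_nonneg (x - y)]
  have hx := sobolevWeight_pos s x
  have hy := sobolevWeight_pos s y
  have h2 : (0 : ℝ) < 2 ^ s := Real.rpow_pos_of_pos two_pos s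
  rcases le_total (x ^ 2) (y ^ 2) with h | h
  · exact (key x y h).trans (mul_le_mul_of_nonneg_left (by linarith) h2.le)
  · rw [add_comm x y]
    exact (key y x h).trans (mul_le_mul_of_nonneg_left (by linarith) h2.le)

/-- The inequality behind `‖∂⁻¹ (u v)‖_r ≤ C ‖u‖_s ‖v‖_r`. -/
theorem sobolevWeight_kernel_le {s r : ℝ} (hs : 0 ≤ s) (hr : 0 ≤ r) (hrs : r ≤ s + 1) (x y : ℝ) :
    sobolevWeight (r - 1) (x + y) * sobolevWeight (-s) x * sobolevWeight (-r) y ≤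
      2 ^ (r + 1) * (sobolevWeight (-1) (x + y) + sobolevWeight (-1) y) := by
  have hp := sobolevWeight_pos
  have h2 : (1 : ℝ) ≤ 2 ^ (r + 1) := Real.one_le_rpow one_le_two (by linarith)
  -- For `r ≥ 1`, Peetre with exponent `r - 1` moves the outer weight onto `x`, where `r - 1 ≤ s`
  -- absorbs it, or onto `y`, where `(1 + y²)^(-1/2)` remains.
  rcases le_total 1 r with h1 | h1
  · have h3 := sobolevWeight_add_arg_le (s := r - 1) (by linarith) x y
    have e1 : sobolevWeight (r - 1) x * sobolevWeight (-s) x ≤ 1 := by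
      rw [← sobolevWeight_add]; exact sobolevWeight_le_one (by linarith) x
    have e2 : sobolevWeight (r - 1) y * sobolevWeight (-r) y = sobolevWeight (-1) y := by
      rw [← sobolevWeight_add]; congr 1; ring
    have e3 : sobolevWeight (-r) y ≤ sobolevWeight (-1) y := sobolevWeight_mono (by linarith) y
    have e4 := sobolevWeight_le_one (s := -s) (by linarith) x
    have e5 : (2 : ℝ) ^ (r + 1) = 4 * 2 ^ (r - 1) := by
      rw [show r + 1 = (r - 1) + 2 by ring, Real.rpow_add two_pos]; norm_num; ring
    have h4 : (0 : ℝ) < 2 ^ (r - 1) := Real.rpow_pos_of_pos two_pos _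
    calc sobolevWeight (r - 1) (x + y) * sobolevWeight (-s) x * sobolevWeight (-r) y
        ≤ 2 ^ (r - 1) * (sobolevWeight (r - 1) x + sobolevWeight (r - 1) y)
            * sobolevWeight (-s) x * sobolevWeight (-r) y := by
          gcongr
          · exact (hp _ _).le
          · exact (hp _ _).le
      _ = 2 ^ (r - 1) * ((sobolevWeight (r - 1) x * sobolevWeight (-s) x) * sobolevWeight (-r) y
            + sobolevWeight (-s) x * (sobolevWeight (r - 1) y * sobolevWeight (-r) y)) := by ring
      _ ≤ 2 ^ (r - 1) * (1 * sobolevWeight (-1) y + 1 * sobolevWeight (-1) y) := by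
          rw [e2]
          gcongr
          · exact (hp _ _).le
          · exact (hp _ _).le
      _ ≤ 2 ^ (r + 1) * (sobolevWeight (-1) (x + y) + sobolevWeight (-1) y) := by
          rw [e5]
          nlinarith [hp (-1) (x + y), hp (-1) y]
  -- For `r ≤ 1` both exponents `r - 1` and `-r` are nonpositive with sum `-1`: the product is a
  -- weighted geometric mean of the two weights of order `-1`.
  · have e1 : sobolevWeight (r - 1) (x + y) * sobolevWeight (-r) y ≤
        sobolevWeight (-1) (x + y) + sobolevWeight (-1) y := by
      have h := Real.geom_mean_le_arith_mean2_weighted (w₁ := 1 - r) (w₂ := r) (by linarith) hr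
        (hp (-1) (x + y)).le (hp (-1) y).le (by ring)
      have f : ∀ z p : ℝ, sobolevWeight (-1) z ^ p = sobolevWeight (-p) z := by
        intro z p
        rw [sobolevWeight, ← Real.rpow_mul (zero_le_one.trans (one_le_one_add_sq z)), sobolevWeight]
        congr 1; ring
      rw [f, f, neg_sub] at h
      nlinarith [hp (-1) (x + y), hp (-1) y]
    have e4 := sobolevWeight_le_one (s := -s) (by linarith) x
    calc sobolevWeight (r - 1) (x + y) * sobolevWeight (-s) x * sobolevWeight (-r) y
        = sobolevWeight (-s) x * (sobolevWeight (r - 1) (x + y) * sobolevWeight (-r) y) := by ring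
      _ ≤ 1 * (sobolevWeight (-1) (x + y) + sobolevWeight (-1) y) :=
          mul_le_mul e4 e1 (mul_pos (hp _ _) (hp _ _)).le zero_le_one
      _ ≤ _ := mul_le_mul_of_nonneg_right h2 (add_pos (hp _ _) (hp _ _)).le

/-- The inequality behind the tame estimate `‖∂⁻¹ (v w)‖_r ≤ C (‖v‖_r ‖w‖_1 + ‖v‖_1 ‖w‖_r)`. -/
theorem sobolevWeight_tame_le {r : ℝ} (hr : 1 ≤ r) (x y : ℝ) :
    sobolevWeight (r - 1) (x + y) * sobolevWeight (-r) x * sobolevWeight (-r) y ≤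
      2 ^ r * (sobolevWeight (-1) y * sobolevWeight (1 - r) y
        + sobolevWeight (-1) y * sobolevWeight (1 - r) x) := by
  have hp := sobolevWeight_pos
  have h3 := sobolevWeight_add_arg_le (s := r - 1) (by linarith) x y
  have e2 : ∀ y, sobolevWeight (r - 1) y * sobolevWeight (-r) y = sobolevWeight (-1) y := by
    intro y; rw [← sobolevWeight_add]; congr 1; ring
  -- The factor of order `1 - r` turns an `H^r`-weighted transform into the `H¹`-weighted one; the
  -- factor of order `-1` is the square integrable weight.
  have e3 : ∀ y, sobolevWeight (-r) y = sobolevWeight (-1) y * sobolevWeight (1 - r) y := by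
    intro y; rw [← sobolevWeight_add]; congr 1; ring
  have e4 := fun y => sobolevWeight_le_one (s := -1) (by norm_num) y
  have e5 : (2 : ℝ) ^ (r - 1) ≤ 2 ^ r := Real.rpow_le_rpow_of_exponent_le one_le_two (by linarith)
  have h4 : (0 : ℝ) < 2 ^ (r - 1) := Real.rpow_pos_of_pos two_pos _
  calc sobolevWeight (r - 1) (x + y) * sobolevWeight (-r) x * sobolevWeight (-r) y
      ≤ 2 ^ (r - 1) * (sobolevWeight (r - 1) x + sobolevWeight (r - 1) y)
          * sobolevWeight (-r) x * sobolevWeight (-r) y := by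
        gcongr
        · exact (hp _ _).le
        · exact (hp _ _).le
    _ = 2 ^ (r - 1) * ((sobolevWeight (r - 1) x * sobolevWeight (-r) x) * sobolevWeight (-r) y
          + sobolevWeight (-r) x * (sobolevWeight (r - 1) y * sobolevWeight (-r) y)) := by ring
    _ = 2 ^ (r - 1) * (sobolevWeight (-1) x * (sobolevWeight (-1) y * sobolevWeight (1 - r) y)
          + sobolevWeight (-1) x * (sobolevWeight (-1) y * sobolevWeight (1 - r) x)) := by
        rw [e2, e2, e3 y, e3 x]; ring
    -- The decay in `x` is given up, so that both terms carry the integrable weight at `y`.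
    _ ≤ 2 ^ (r - 1) * (1 * (sobolevWeight (-1) y * sobolevWeight (1 - r) y)
          + 1 * (sobolevWeight (-1) y * sobolevWeight (1 - r) x)) := by
        have := mul_pos (hp (-1) y) (hp (1 - r) y)
        have := mul_pos (hp (-1) y) (hp (1 - r) x)
        gcongr <;> exact e4 x
    _ ≤ _ := by
        rw [one_mul, one_mul]
        have := mul_pos (hp (-1) y) (hp (1 - r) y)
        have := mul_pos (hp (-1) y) (hp (1 - r) x)
        gcongr

end Weight

/-! ## Estimates for convolutions of nonnegative functions -/

section LConv

open scoped ENNReal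

variable {G : Type*} [MeasurableSpace G] {μ : Measure G}

theorem eLpNorm_two_sq {ε : Type*} [TopologicalSpace ε] [ContinuousENorm ε] (f : G → ε) :
    eLpNorm f 2 μ ^ 2 = ∫⁻ x, ‖f x‖ₑ ^ 2 ∂μ := by
  have := eLpNorm_nnreal_pow_eq_lintegral (μ := μ) (f := f) (p := 2) two_ne_zero
  simpa using this

/-- The Cauchy–Schwarz inequality. -/
theorem sq_lintegral_mul_le {f g : G → ℝ≥0∞} (hf : AEMeasurable f μ) (hg : AEMeasurable g μ) :
    (∫⁻ x, f x * g x ∂μ) ^ 2 ≤ (∫⁻ x, f x ^ 2 ∂μ) * ∫⁻ x, g x ^ 2 ∂μ := by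
  have h := ENNReal.lintegral_mul_norm_pow_le (μ := μ) (hf.pow_const 2) (hg.pow_const 2)
    (p := 1 / 2) (q := 1 / 2) (by norm_num) (by norm_num) (by norm_num)
  have e : ∀ a : ℝ≥0∞, (a ^ 2) ^ (1 / 2 : ℝ) = a := fun a => by
    rw [← ENNReal.rpow_natCast, ← ENNReal.rpow_mul]; norm_num
  have e' : ∀ a : ℝ≥0∞, (a ^ (1 / 2 : ℝ)) ^ 2 = a := fun a => by
    rw [← ENNReal.rpow_natCast, ← ENNReal.rpow_mul]; norm_num
  simp only [e] at h
  calc _ ≤ ((∫⁻ x, f x ^ 2 ∂μ) ^ (1 / 2 : ℝ) * (∫⁻ x, g x ^ 2 ∂μ) ^ (1 / 2 : ℝ)) ^ 2 :=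
        pow_le_pow_left' h 2
    _ = _ := by rw [mul_pow, e', e']

/-- Cauchy–Schwarz for the splitting `(f √g) · √g`, which is what Young's inequality needs. -/
theorem sq_lintegral_mul_le_weighted {f g : G → ℝ≥0∞} (hf : AEMeasurable f μ)
    (hg : AEMeasurable g μ) :
    (∫⁻ x, f x * g x ∂μ) ^ 2 ≤ (∫⁻ x, f x ^ 2 * g x ∂μ) * ∫⁻ x, g x ∂μ := by
  have h := sq_lintegral_mul_le (μ := μ) (f := fun x => f x * g x ^ (1 / 2 : ℝ))
    (g := fun x => g x ^ (1 / 2 : ℝ)) (hf.mul (hg.pow_const _)) (hg.pow_const _)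
  have e' : ∀ a : ℝ≥0∞, (a ^ (1 / 2 : ℝ)) ^ 2 = a := fun a => by
    rw [← ENNReal.rpow_natCast, ← ENNReal.rpow_mul]; norm_num
  simpa only [mul_pow, e', mul_assoc, ← sq] using h

variable [AddCommGroup G] [MeasurableAdd₂ G] [MeasurableNeg G] [SFinite μ]
  [μ.IsAddLeftInvariant] [μ.IsNegInvariant]

theorem lintegral_conv_le {f g : G → ℝ≥0∞} (hf : Measurable f) (hg : Measurable g) (k : G) :
    ∫⁻ l, f (k - l) * g l ∂μ ≤ eLpNorm f 2 μ * eLpNorm g 2 μ := by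
  have h := sq_lintegral_mul_le (μ := μ) (f := fun l => f (k - l)) (g := g)
    (by fun_prop) (by fun_prop)
  rw [lintegral_sub_left_eq_self (fun l => f l ^ 2) k] at h
  have h1 := eLpNorm_two_sq (μ := μ) f
  have h2 := eLpNorm_two_sq (μ := μ) g
  simp only [enorm_eq_self] at h1 h2
  rw [← h1, ← h2, ← mul_pow] at h
  exact (ENNReal.pow_le_pow_left_iff two_ne_zero).1 h

/-- Weight on the output: the convolution of two `L²` functions is bounded, and `w` supplies the
decay. -/
theorem eLpNorm_mul_conv_le {w f g : G → ℝ≥0∞} (hw : Measurable w) (hf : Measurable f)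
    (hg : Measurable g) :
    eLpNorm (fun k => w k * ∫⁻ l, f (k - l) * g l ∂μ) 2 μ ≤
      eLpNorm w 2 μ * eLpNorm f 2 μ * eLpNorm g 2 μ := by
  refine (eLpNorm_le_mul_eLpNorm_of_ae_le_mul'' (c := eLpNorm f 2 μ * eLpNorm g 2 μ) (g := w) 2
    hw.aestronglyMeasurable (ae_of_all _ fun k => ?_)).trans_eq (by ring)
  simp only [enorm_eq_self]
  rw [mul_comm]
  gcongr
  exact lintegral_conv_le hf hg k

/-- Young's inequality `L² ⋆ L¹ ⊆ L²`, by weighted Cauchy–Schwarz in `l` followed by Tonelli. -/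
theorem eLpNorm_conv_le {f g : G → ℝ≥0∞} (hf : Measurable f) (hg : Measurable g) :
    eLpNorm (fun k => ∫⁻ l, f (k - l) * g l ∂μ) 2 μ ≤ eLpNorm f 2 μ * ∫⁻ l, g l ∂μ := by
  refine (ENNReal.pow_le_pow_left_iff two_ne_zero).1 ?_
  rw [eLpNorm_two_sq, mul_pow, eLpNorm_two_sq]
  simp only [enorm_eq_self]
  calc ∫⁻ k, (∫⁻ l, f (k - l) * g l ∂μ) ^ 2 ∂μ
      ≤ ∫⁻ k, (∫⁻ l, f (k - l) ^ 2 * g l ∂μ) * ∫⁻ l, g l ∂μ ∂μ :=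
        lintegral_mono fun k => sq_lintegral_mul_le_weighted (by fun_prop) (by fun_prop)
    _ = (∫⁻ k, ∫⁻ l, f (k - l) ^ 2 * g l ∂μ ∂μ) * ∫⁻ l, g l ∂μ :=
        lintegral_mul_const _ (by fun_prop)
    _ = (∫⁻ l, ∫⁻ k, f (k - l) ^ 2 * g l ∂μ ∂μ) * ∫⁻ l, g l ∂μ := by
        rw [lintegral_lintegral_swap (by fun_prop)]
    _ = (∫⁻ l, (∫⁻ k, f k ^ 2 ∂μ) * g l ∂μ) * ∫⁻ l, g l ∂μ := by
        congr 2 with l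
        rw [lintegral_mul_const _ (by fun_prop), lintegral_sub_right_eq_self (fun k => f k ^ 2) l]
    _ = _ := by rw [lintegral_const_mul _ hg, sq (∫⁻ l, g l ∂μ), mul_assoc]

/-- Weight on an input: `w g` is in `L¹` by Cauchy–Schwarz, and Young's inequality applies. -/
theorem eLpNorm_conv_mul_le {w f g : G → ℝ≥0∞} (hw : Measurable w) (hf : Measurable f)
    (hg : Measurable g) :
    eLpNorm (fun k => ∫⁻ l, f (k - l) * (w l * g l) ∂μ) 2 μ ≤
      eLpNorm w 2 μ * eLpNorm f 2 μ * eLpNorm g 2 μ := by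
  refine (eLpNorm_conv_le hf (hw.mul hg)).trans ?_
  have h := sq_lintegral_mul_le (μ := μ) hw.aemeasurable hg.aemeasurable
  have h1 := eLpNorm_two_sq (μ := μ) w
  have h2 := eLpNorm_two_sq (μ := μ) g
  simp only [enorm_eq_self] at h1 h2
  rw [← h1, ← h2, ← mul_pow] at h
  have h3 := (ENNReal.pow_le_pow_left_iff two_ne_zero).1 h
  calc _ ≤ eLpNorm f 2 μ * (eLpNorm w 2 μ * eLpNorm g 2 μ) := by gcongr; exact h3
    _ = _ := by ring

end LConv

/-! ## Convolution of square integrable functions -/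

section FConv

open scoped ENNReal

variable {G : Type*} [MeasurableSpace G] [AddCommGroup G] {μ : Measure G}

/-- The convolution `∫ f(k - l) g(l) dl`. -/
noncomputable def fourierConv (μ : Measure G) (f g : G → ℂ) (k : G) : ℂ :=
  ∫ l, f (k - l) * g l ∂μ

variable [MeasurableAdd₂ G] [MeasurableNeg G] [μ.IsAddLeftInvariant] [μ.IsNegInvariant]
  {f g f' g' : G → ℂ}

theorem measurePreserving_const_sub (k : G) : MeasurePreserving (fun l => k - l) μ μ :=
  μ.measurePreserving_sub_left k

/-- Equality at every point, not just almost everywhere: `l ↦ k - l` preserves null sets for each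
fixed `k`. Representatives may therefore be changed freely inside a convolution. -/
theorem fourierConv_congr (hf : f =ᵐ[μ] f') (hg : g =ᵐ[μ] g') :
    fourierConv μ f g = fourierConv μ f' g' := by
  funext k
  have h := (measurePreserving_const_sub (μ := μ) k).quasiMeasurePreserving.ae_eq hf
  refine integral_congr_ae ?_
  filter_upwards [h, hg] with l h1 h2
  simp only [Function.comp_apply] at h1
  rw [h1, h2]

theorem integrable_fourierConv (hf : MemLp f 2 μ) (hg : MemLp g 2 μ) (k : G) :
    Integrable (fun l => f (k - l) * g l) μ :=
  (hf.comp_measurePreserving (measurePreserving_const_sub k)).integrable_mul hg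

theorem fourierConv_comm (f g : G → ℂ) : fourierConv μ f g = fourierConv μ g f := by
  funext k
  rw [fourierConv, ← integral_sub_left_eq_self _ μ k]
  simp only [sub_sub_cancel, mul_comm, fourierConv]

theorem fourierConv_add_left (hf : MemLp f 2 μ) (hf' : MemLp f' 2 μ) (hg : MemLp g 2 μ) :
    fourierConv μ (f + f') g = fourierConv μ f g + fourierConv μ f' g := by
  funext k
  simp only [fourierConv, Pi.add_apply, add_mul]
  exact integral_add (integrable_fourierConv hf hg k) (integrable_fourierConv hf' hg k)

theorem fourierConv_add_right (hf : MemLp f 2 μ) (hg : MemLp g 2 μ) (hg' : MemLp g' 2 μ) :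
    fourierConv μ f (g + g') = fourierConv μ f g + fourierConv μ f g' := by
  rw [fourierConv_comm, fourierConv_add_left hg hg' hf, fourierConv_comm g, fourierConv_comm g']

omit [MeasurableAdd₂ G] [MeasurableNeg G] [μ.IsAddLeftInvariant] [μ.IsNegInvariant] in
theorem fourierConv_smul_left (c : ℂ) (f g : G → ℂ) :
    fourierConv μ (c • f) g = c • fourierConv μ f g := by
  funext k
  simp only [fourierConv, Pi.smul_apply, smul_eq_mul, mul_assoc]
  exact integral_const_mul _ _

theorem fourierConv_smul_right (c : ℂ) (f g : G → ℂ) :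
    fourierConv μ f (c • g) = c • fourierConv μ f g := by
  rw [fourierConv_comm, fourierConv_smul_left, fourierConv_comm]

theorem aestronglyMeasurable_fourierConv [SFinite μ] (hf : AEStronglyMeasurable f μ)
    (hg : AEStronglyMeasurable g μ) : AEStronglyMeasurable (fourierConv μ f g) μ := by
  have := (hg.convolution_integrand (ContinuousLinearMap.mul ℂ ℂ) hf).integral_prod_right'
  refine this.congr (ae_of_all _ fun k => ?_)
  simp only [fourierConv, ContinuousLinearMap.mul_apply', mul_comm]

variable [SFinite μ]

/-- A weighted convolution whose kernel is bounded by `C (w(k) + w(l))`. -/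
theorem eLpNorm_mul_fourierConv_le {c p q : G → ℂ} {w : G → ℝ} {C : NNReal} (hw : Measurable w)
    (hw0 : ∀ k, 0 ≤ w k) (hf : Measurable f) (hg : Measurable g)
    (h : ∀ k l, ‖c (k + l)‖ * ‖p k‖ * ‖q l‖ ≤ C * (w (k + l) + w l)) :
    eLpNorm (fun k => c k * fourierConv μ (fun l => p l * f l) (fun l => q l * g l) k) 2 μ ≤
      C * (2 * eLpNorm w 2 μ * eLpNorm f 2 μ * eLpNorm g 2 μ) := by
  set W : G → ℝ≥0∞ := fun k => ‖w k‖ₑ with hW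
  have hWm : Measurable W := by fun_prop
  have hfm : Measurable fun k => ‖f k‖ₑ := by fun_prop
  have hgm : Measurable fun k => ‖g k‖ₑ := by fun_prop
  have h' : ∀ k l, ‖c k‖ₑ * ‖p (k - l)‖ₑ * ‖q l‖ₑ ≤ C * (W k + W l) := by
    intro k l
    have h1 := h (k - l) l
    rw [sub_add_cancel] at h1
    have h2 := ENNReal.ofReal_le_ofReal h1
    rw [ENNReal.ofReal_mul (by positivity), ENNReal.ofReal_mul (by positivity),
      ENNReal.ofReal_mul C.coe_nonneg, ENNReal.ofReal_add (hw0 _) (hw0 _), ENNReal.ofReal_coe_nnreal] at h2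
    simpa only [ofReal_norm, hW, Real.enorm_of_nonneg (hw0 _)] using h2
  -- The summand `w(k)` leaves the integral (weight on the output) and `w(l)` stays inside (weight
  -- on an input).
  have key : ∀ k, ‖c k * fourierConv μ (fun l => p l * f l) (fun l => q l * g l) k‖ₑ ≤
      C * ((W k * ∫⁻ l, ‖f (k - l)‖ₑ * ‖g l‖ₑ ∂μ)
        + ∫⁻ l, ‖f (k - l)‖ₑ * (W l * ‖g l‖ₑ) ∂μ) := by
    intro k
    rw [enorm_mul]
    calc ‖c k‖ₑ * ‖fourierConv μ (fun l => p l * f l) (fun l => q l * g l) k‖ₑ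
        ≤ ‖c k‖ₑ * ∫⁻ l, ‖p (k - l) * f (k - l) * (q l * g l)‖ₑ ∂μ := by
          gcongr; exact enorm_integral_le_lintegral_enorm _
      _ = ∫⁻ l, ‖c k‖ₑ * ‖p (k - l) * f (k - l) * (q l * g l)‖ₑ ∂μ :=
          (lintegral_const_mul' _ _ enorm_ne_top).symm
      _ ≤ ∫⁻ l, C * (W k * (‖f (k - l)‖ₑ * ‖g l‖ₑ) + ‖f (k - l)‖ₑ * (W l * ‖g l‖ₑ)) ∂μ := by
          refine lintegral_mono fun l => ?_
          calc _ = (‖c k‖ₑ * ‖p (k - l)‖ₑ * ‖q l‖ₑ) * (‖f (k - l)‖ₑ * ‖g l‖ₑ) := by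
                simp only [enorm_mul]; ring
            _ ≤ (C * (W k + W l)) * (‖f (k - l)‖ₑ * ‖g l‖ₑ) := by gcongr ?_ * _; exact h' k l
            _ = _ := by ring
      _ = _ := by
          rw [lintegral_const_mul' _ _ ENNReal.coe_ne_top, lintegral_add_left (by fun_prop),
            lintegral_const_mul' _ _ enorm_ne_top]
  refine (eLpNorm_le_mul_eLpNorm_of_ae_le_mul' (c := C)
    (g := (fun k => W k * ∫⁻ l, ‖f (k - l)‖ₑ * ‖g l‖ₑ ∂μ) +
      fun k => ∫⁻ l, ‖f (k - l)‖ₑ * (W l * ‖g l‖ₑ) ∂μ)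
    (ae_of_all _ key) 2).trans ?_
  gcongr
  refine (eLpNorm_add_le (Measurable.aestronglyMeasurable (by fun_prop))
    (Measurable.aestronglyMeasurable (by fun_prop)) one_le_two).trans ?_
  have e : ∀ u : G → ℂ, eLpNorm (fun k => ‖u k‖ₑ) 2 μ = eLpNorm u 2 μ := fun u =>
    eLpNorm_enorm u
  have e' : eLpNorm W 2 μ = eLpNorm w 2 μ := eLpNorm_enorm w
  have h1 := eLpNorm_mul_conv_le (μ := μ) hWm hfm hgm
  have h2 := eLpNorm_conv_mul_le (μ := μ) hWm hfm hgm
  rw [e, e, e'] at h1 h2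
  exact (add_le_add h1 h2).trans_eq (by ring)

/-- A weighted convolution whose kernel is bounded by `C w(l) (v(l) + v(k - l))`. -/
theorem eLpNorm_mul_fourierConv_self_le {c p q : G → ℂ} {w v : G → ℝ} {C : NNReal}
    (hw : Measurable w) (hw0 : ∀ k, 0 ≤ w k) (hv : Measurable v) (hv0 : ∀ k, 0 ≤ v k)
    (hf : Measurable f)
    (h : ∀ k l, ‖c (k + l)‖ * ‖p k‖ * ‖q l‖ ≤ C * (w l * v l + w l * v k)) :
    eLpNorm (fun k => c k * fourierConv μ (fun l => p l * f l) (fun l => q l * f l) k) 2 μ ≤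
      C * (2 * eLpNorm w 2 μ * eLpNorm f 2 μ * eLpNorm (fun k => (v k : ℂ) * f k) 2 μ) := by
  set W : G → ℝ≥0∞ := fun k => ‖w k‖ₑ with hW
  set V : G → ℝ≥0∞ := fun k => ‖(v k : ℂ) * f k‖ₑ with hV
  have hVe : ∀ k, V k = ‖v k‖ₑ * ‖f k‖ₑ := fun k => by
    simp only [hV, enorm_mul]
    congr 1
    rw [← ofReal_norm, ← ofReal_norm, Complex.norm_real]
  have hWm : Measurable W := by fun_prop
  have hfm : Measurable fun k => ‖f k‖ₑ := by fun_prop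
  have hVm : Measurable V := by fun_prop
  have h' : ∀ k l, ‖c k‖ₑ * ‖p (k - l)‖ₑ * ‖q l‖ₑ ≤ C * (W l * ‖v l‖ₑ + W l * ‖v (k - l)‖ₑ) := by
    intro k l
    have h1 := h (k - l) l
    rw [sub_add_cancel] at h1
    have h2 := ENNReal.ofReal_le_ofReal h1
    rw [ENNReal.ofReal_mul (by positivity), ENNReal.ofReal_mul (by positivity),
      ENNReal.ofReal_mul C.coe_nonneg, ENNReal.ofReal_add (mul_nonneg (hw0 _) (hv0 _))
      (mul_nonneg (hw0 _) (hv0 _)), ENNReal.ofReal_coe_nnreal, ENNReal.ofReal_mul (hw0 _),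
      ENNReal.ofReal_mul (hw0 _)] at h2
    simpa only [ofReal_norm, hW, Real.enorm_of_nonneg (hw0 _),
      Real.enorm_of_nonneg (hv0 _)] using h2
  have key : ∀ k, ‖c k * fourierConv μ (fun l => p l * f l) (fun l => q l * f l) k‖ₑ ≤
      C * ((∫⁻ l, ‖f (k - l)‖ₑ * (W l * V l) ∂μ)
        + ∫⁻ l, V (k - l) * (W l * ‖f l‖ₑ) ∂μ) := by
    intro k
    rw [enorm_mul]
    calc ‖c k‖ₑ * ‖fourierConv μ (fun l => p l * f l) (fun l => q l * f l) k‖ₑ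
        ≤ ‖c k‖ₑ * ∫⁻ l, ‖p (k - l) * f (k - l) * (q l * f l)‖ₑ ∂μ := by
          gcongr; exact enorm_integral_le_lintegral_enorm _
      _ = ∫⁻ l, ‖c k‖ₑ * ‖p (k - l) * f (k - l) * (q l * f l)‖ₑ ∂μ :=
          (lintegral_const_mul' _ _ enorm_ne_top).symm
      _ ≤ ∫⁻ l, C * (‖f (k - l)‖ₑ * (W l * V l) + V (k - l) * (W l * ‖f l‖ₑ)) ∂μ := by
          refine lintegral_mono fun l => ?_
          calc _ = (‖c k‖ₑ * ‖p (k - l)‖ₑ * ‖q l‖ₑ) * (‖f (k - l)‖ₑ * ‖f l‖ₑ) := by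
                simp only [enorm_mul]; ring
            _ ≤ (C * (W l * ‖v l‖ₑ + W l * ‖v (k - l)‖ₑ)) * (‖f (k - l)‖ₑ * ‖f l‖ₑ) := by
                gcongr ?_ * _; exact h' k l
            _ = _ := by rw [hVe, hVe]; ring
      _ = _ := by
          rw [lintegral_const_mul' _ _ ENNReal.coe_ne_top, lintegral_add_left (by fun_prop)]
  refine (eLpNorm_le_mul_eLpNorm_of_ae_le_mul' (c := C)
    (g := (fun k => ∫⁻ l, ‖f (k - l)‖ₑ * (W l * V l) ∂μ) +
      fun k => ∫⁻ l, V (k - l) * (W l * ‖f l‖ₑ) ∂μ)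
    (ae_of_all _ key) 2).trans ?_
  gcongr
  refine (eLpNorm_add_le (Measurable.aestronglyMeasurable (by fun_prop))
    (Measurable.aestronglyMeasurable (by fun_prop)) one_le_two).trans ?_
  have e : ∀ u : G → ℂ, eLpNorm (fun k => ‖u k‖ₑ) 2 μ = eLpNorm u 2 μ := fun u =>
    eLpNorm_enorm u
  have e' : eLpNorm W 2 μ = eLpNorm w 2 μ := eLpNorm_enorm w
  have h1 := eLpNorm_conv_mul_le (μ := μ) hWm hfm hVm
  have h2 := eLpNorm_conv_mul_le (μ := μ) hWm hVm hfm
  rw [e, e, e'] at h1 h2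
  exact (add_le_add h1 h2).trans_eq (by ring)

/-- Young's inequality `‖f ⋆ g‖₂ ≤ ‖f‖₂ ‖g‖₁`, the second norm being controlled by a weight. -/
theorem eLpNorm_fourierConv_le {w : G → ℝ} (hw : Measurable w) (hw0 : ∀ k, 0 < w k)
    (hf : Measurable f) (hg : Measurable g) :
    eLpNorm (fourierConv μ f g) 2 μ ≤
      eLpNorm w 2 μ * eLpNorm f 2 μ * eLpNorm (fun k => ((w k)⁻¹ : ℂ) * g k) 2 μ := by
  have h := eLpNorm_conv_mul_le (μ := μ) (w := fun k => ‖w k‖ₑ) (f := fun k => ‖f k‖ₑ)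
    (g := fun k => ‖((w k)⁻¹ : ℂ) * g k‖ₑ) (by fun_prop) (by fun_prop) (by fun_prop)
  have e : ∀ u : G → ℂ, eLpNorm (fun k => ‖u k‖ₑ) 2 μ = eLpNorm u 2 μ := fun u =>
    eLpNorm_enorm u
  have e' : eLpNorm (fun k => ‖w k‖ₑ) 2 μ = eLpNorm w 2 μ := eLpNorm_enorm w
  rw [e, e, e'] at h
  refine le_trans (eLpNorm_mono_enorm fun k => ?_) h
  refine (enorm_integral_le_lintegral_enorm _).trans_eq ?_
  rw [enorm_eq_self]
  refine lintegral_congr fun l => ?_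
  have e1 : ‖w l‖ₑ = ‖(w l : ℂ)‖ₑ := by
    rw [← ofReal_norm, ← ofReal_norm, Complex.norm_real]
  have hne : (w l : ℂ) ≠ 0 := by exact_mod_cast (hw0 l).ne'
  rw [e1, ← enorm_mul, ← mul_assoc, mul_inv_cancel₀ hne, one_mul, enorm_mul]

end FConv

/-! ## Dispersive equations on the Fourier side -/

/-- A group of frequencies, with its wave number `κ`, on which `(1 + κ²)⁻¹` is integrable. -/
structure FrequencySpace {G : Type*} [AddCommGroup G] [MeasurableSpace G] (μ : Measure G) where
  κ : G →+ ℝ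
  measurable : Measurable κ
  memLp : MemLp (fun k => sobolevWeight (-1) (κ k)) 2 μ

/-- An even symbol comparable to `1 + x²`. -/
structure DispersionSymbol where
  m : ℝ → ℝ
  measurable : Measurable m
  even : ∀ x, m (-x) = m x
  lower : ℝ
  upper : ℝ
  lower_pos : 0 < lower
  lower_le : ∀ x, lower * (1 + x ^ 2) ≤ m x
  le_upper : ∀ x, m x ≤ upper * (1 + x ^ 2)

namespace DispersionSymbol

variable (D : DispersionSymbol)

/-- The symbol `-i x / m(x)`. -/
noncomputable def coeff (x : ℝ) : ℂ := -Complex.I * ((x / D.m x : ℝ) : ℂ)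

theorem m_pos (x : ℝ) : 0 < D.m x :=
  (mul_pos D.lower_pos (zero_lt_one.trans_le (one_le_one_add_sq x))).trans_le (D.lower_le x)

theorem measurable_coeff : Measurable D.coeff := by
  have := D.measurable
  unfold coeff
  fun_prop

/-- The gain of one derivative: `|x| ≤ (1 + x²)^(1/2)` against `m(x) ≥ lower (1 + x²)`. -/
theorem norm_coeff_le (x : ℝ) : ‖D.coeff x‖ ≤ D.lower⁻¹ * sobolevWeight (-1) x := by
  have h1 : ‖D.coeff x‖ = |x| / D.m x := by
    rw [coeff, norm_mul, norm_neg, Complex.norm_I, one_mul, Complex.norm_real, Real.norm_eq_abs,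
      abs_div, abs_of_pos (D.m_pos x)]
  have h2 := D.lower_le x
  rw [← sobolevWeight_two] at h2
  have hp := sobolevWeight_pos
  have e : sobolevWeight 1 x = sobolevWeight (-1) x * sobolevWeight 2 x := by
    rw [← sobolevWeight_add]; norm_num
  rw [h1, div_le_iff₀ (D.m_pos x)]
  have hl := D.lower_pos
  calc |x| ≤ sobolevWeight 1 x := abs_le_sobolevWeight_one x
    _ = D.lower⁻¹ * sobolevWeight (-1) x * (D.lower * sobolevWeight 2 x) := by
        rw [e]; field_simp
    _ ≤ _ := mul_le_mul_of_nonneg_left h2 (mul_pos (inv_pos.2 hl) (hp _ _)).le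

theorem norm_coeff_le_const (x : ℝ) : ‖D.coeff x‖ ≤ D.lower⁻¹ :=
  (D.norm_coeff_le x).trans
    (mul_le_of_le_one_right (inv_pos.2 D.lower_pos).le (sobolevWeight_le_one (by norm_num) x))

end DispersionSymbol

/-! ### Multiplication operators on `L²`. -/

section MulL2

open scoped ENNReal

variable {G : Type*} [MeasurableSpace G] {μ : Measure G}

/-- Multiplication by a bounded function. -/
noncomputable def mulL2 (q : G → ℂ) (hq : MemLp q ∞ μ) : Lp ℂ 2 μ →L[ℂ] Lp ℂ 2 μ :=
  (ContinuousLinearMap.mul ℂ ℂ).holderL μ ∞ 2 2 (hq.toLp q)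

theorem coeFn_mulL2 (q : G → ℂ) (hq : MemLp q ∞ μ) (f : Lp ℂ 2 μ) :
    mulL2 q hq f =ᵐ[μ] fun k => q k * f k := by
  have h := (ContinuousLinearMap.mul ℂ ℂ).coeFn_holder (r := 2) (hq.toLp q) f
  filter_upwards [h, hq.coeFn_toLp] with k h1 h2
  rw [← h2]
  exact h1

end MulL2

/-! ### The bilinear operator and the vector field on weighted transforms. -/

namespace FrequencySpace

open scoped ENNReal

variable {G : Type*} [AddCommGroup G] [MeasurableSpace G] {μ : Measure G} (X : FrequencySpace μ)
  (D : DispersionSymbol)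

/-- The weight `(1 + κ(k)²)^(s/2)`, as a complex number. -/
noncomputable def wt (s : ℝ) (k : G) : ℂ := (sobolevWeight s (X.κ k) : ℂ)

theorem measurable_wt (s : ℝ) : Measurable (X.wt s) :=
  Complex.measurable_ofReal.comp ((continuous_sobolevWeight s).measurable.comp X.measurable)

theorem norm_wt (s : ℝ) (k : G) : ‖X.wt s k‖ = sobolevWeight s (X.κ k) := by
  rw [wt, Complex.norm_real, Real.norm_of_nonneg (sobolevWeight_pos _ _).le]

theorem wt_ne_zero (s : ℝ) (k : G) : X.wt s k ≠ 0 := by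
  rw [wt]
  exact_mod_cast (sobolevWeight_pos s (X.κ k)).ne'

theorem wt_mul_wt (s t : ℝ) (k : G) : X.wt s k * X.wt t k = X.wt (s + t) k := by
  rw [wt, wt, wt, sobolevWeight_add, Complex.ofReal_mul]

theorem wt_zero (k : G) : X.wt 0 k = 1 := by rw [wt, sobolevWeight_zero, Complex.ofReal_one]

theorem memLp_wt_top {s : ℝ} (hs : s ≤ 0) : MemLp (X.wt s) ∞ μ :=
  memLp_top_of_bound (X.measurable_wt s).aestronglyMeasurable 1
    (ae_of_all _ fun k => (X.norm_wt s k).trans_le (sobolevWeight_le_one hs _))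

theorem memLp_wt_mul {s : ℝ} (hs : s ≤ 0) {f : G → ℂ} (hf : MemLp f 2 μ) :
    MemLp (fun k => X.wt s k * f k) 2 μ :=
  hf.mul (X.memLp_wt_top hs)

/-- The Fourier transform of `Aⱼ(u v)` with a weight, in terms of the weighted transforms of `u`
and `v`. -/
noncomputable def convWeighted (s r : ℝ) (f g : G → ℂ) (k : G) : ℂ :=
  (D.coeff (X.κ k) * X.wt r k) *
    fourierConv μ (fun l => X.wt (-s) l * f l) (fun l => X.wt (-r) l * g l) k

variable [MeasurableAdd₂ G] [MeasurableNeg G] [SFinite μ] [μ.IsAddLeftInvariant]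
  [μ.IsNegInvariant] {s r : ℝ} {f g f' g' : G → ℂ}

omit [SFinite μ] in
theorem convWeighted_congr (hf : f =ᵐ[μ] f') (hg : g =ᵐ[μ] g') :
    X.convWeighted D s r f g = X.convWeighted D s r f' g' := by
  funext k
  rw [convWeighted, convWeighted, fourierConv_congr (hf.mono fun l h => by rw [h])
    (hg.mono fun l h => by rw [h])]

omit [SFinite μ] in
theorem convWeighted_add_left (hs : 0 ≤ s) (hr : 0 ≤ r) (hf : MemLp f 2 μ) (hf' : MemLp f' 2 μ)
    (hg : MemLp g 2 μ) :
    X.convWeighted D s r (f + f') g = X.convWeighted D s r f g + X.convWeighted D s r f' g := by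
  funext k
  have e : (fun l => X.wt (-s) l * (f + f') l) =
      (fun l => X.wt (-s) l * f l) + fun l => X.wt (-s) l * f' l := by
    funext l; simp [mul_add]
  rw [Pi.add_apply, convWeighted, e, fourierConv_add_left (X.memLp_wt_mul (by linarith) hf)
    (X.memLp_wt_mul (by linarith) hf') (X.memLp_wt_mul (by linarith) hg), Pi.add_apply, mul_add]
  rfl

omit [SFinite μ] in
theorem convWeighted_add_right (hs : 0 ≤ s) (hr : 0 ≤ r) (hf : MemLp f 2 μ) (hg : MemLp g 2 μ)
    (hg' : MemLp g' 2 μ) :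
    X.convWeighted D s r f (g + g') = X.convWeighted D s r f g + X.convWeighted D s r f g' := by
  funext k
  have e : (fun l => X.wt (-r) l * (g + g') l) =
      (fun l => X.wt (-r) l * g l) + fun l => X.wt (-r) l * g' l := by
    funext l; simp [mul_add]
  rw [Pi.add_apply, convWeighted, e, fourierConv_add_right (X.memLp_wt_mul (by linarith) hf)
    (X.memLp_wt_mul (by linarith) hg) (X.memLp_wt_mul (by linarith) hg'), Pi.add_apply, mul_add]
  rfl

omit [MeasurableAdd₂ G] [MeasurableNeg G] [SFinite μ] [μ.IsAddLeftInvariant]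
  [μ.IsNegInvariant] in
theorem convWeighted_smul_left (c : ℂ) :
    X.convWeighted D s r (c • f) g = c • X.convWeighted D s r f g := by
  funext k
  have e : (fun l => X.wt (-s) l * (c • f) l) = c • fun l => X.wt (-s) l * f l := by
    funext l; simp [mul_left_comm]
  rw [Pi.smul_apply, convWeighted, e, fourierConv_smul_left, Pi.smul_apply, convWeighted,
    smul_eq_mul, smul_eq_mul, mul_left_comm]

omit [SFinite μ] in
theorem convWeighted_smul_right (c : ℂ) :
    X.convWeighted D s r f (c • g) = c • X.convWeighted D s r f g := by
  funext k
  have e : (fun l => X.wt (-r) l * (c • g) l) = c • fun l => X.wt (-r) l * g l := by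
    funext l; simp [mul_left_comm]
  rw [Pi.smul_apply, convWeighted, e, fourierConv_smul_right, Pi.smul_apply, convWeighted,
    smul_eq_mul, smul_eq_mul, mul_left_comm]

theorem aestronglyMeasurable_convWeighted (hf : AEStronglyMeasurable f μ)
    (hg : AEStronglyMeasurable g μ) : AEStronglyMeasurable (X.convWeighted D s r f g) μ := by
  have h1 := (D.measurable_coeff.comp X.measurable).mul (X.measurable_wt r)
  exact h1.aestronglyMeasurable.mul (aestronglyMeasurable_fourierConv
    ((X.measurable_wt _).aestronglyMeasurable.mul hf)
    ((X.measurable_wt _).aestronglyMeasurable.mul hg))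

omit [MeasurableAdd₂ G] [MeasurableNeg G] [SFinite μ] [μ.IsAddLeftInvariant]
  [μ.IsNegInvariant] in
theorem norm_coeff_mul_wt_le (r : ℝ) (k : G) :
    ‖D.coeff (X.κ k) * X.wt r k‖ ≤ D.lower⁻¹ * sobolevWeight (r - 1) (X.κ k) := by
  rw [norm_mul, norm_wt, sub_eq_neg_add, sobolevWeight_add, ← mul_assoc]
  exact mul_le_mul_of_nonneg_right (D.norm_coeff_le _) (sobolevWeight_pos _ _).le

/-- The constant of the bilinear estimate. -/
noncomputable def bilinConst (r : ℝ) : NNReal :=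
  (D.lower⁻¹ * 2 ^ (r + 1)).toNNReal * (2 * eLpNorm (fun k => sobolevWeight (-1) (X.κ k)) 2 μ).toNNReal

/-- This is `‖Aⱼ(u v)‖_r ≤ C ‖u‖_s ‖v‖_r`: the kernel inequality supplies the hypothesis of
`eLpNorm_mul_fourierConv_le`. -/
theorem eLpNorm_convWeighted_le (hs : 0 ≤ s) (hr : 0 ≤ r) (hrs : r ≤ s + 1) (hf : Measurable f)
    (hg : Measurable g) :
    eLpNorm (X.convWeighted D s r f g) 2 μ ≤
      X.bilinConst D r * (eLpNorm f 2 μ * eLpNorm g 2 μ) := by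
  have hC : 0 ≤ D.lower⁻¹ * 2 ^ (r + 1) :=
    mul_nonneg (inv_pos.2 D.lower_pos).le (Real.rpow_nonneg two_pos.le _)
  refine (eLpNorm_mul_fourierConv_le (C := (D.lower⁻¹ * 2 ^ (r + 1)).toNNReal)
    (w := fun k => sobolevWeight (-1) (X.κ k))
    ((continuous_sobolevWeight _).measurable.comp X.measurable)
    (fun k => (sobolevWeight_pos _ _).le) hf hg fun k l => ?_).trans_eq ?_
  · rw [Real.coe_toNNReal _ hC, norm_wt, norm_wt, map_add]
    have h1 := X.norm_coeff_mul_wt_le D r (k + l)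
    rw [map_add] at h1
    have h2 := sobolevWeight_kernel_le hs hr hrs (X.κ k) (X.κ l)
    have hp := sobolevWeight_pos
    calc _ ≤ D.lower⁻¹ * sobolevWeight (r - 1) (X.κ k + X.κ l) * sobolevWeight (-s) (X.κ k) *
            sobolevWeight (-r) (X.κ l) := by
          have := (hp (-s) (X.κ k)).le
          have := (hp (-r) (X.κ l)).le
          gcongr
      _ = D.lower⁻¹ * (sobolevWeight (r - 1) (X.κ k + X.κ l) * sobolevWeight (-s) (X.κ k) *
            sobolevWeight (-r) (X.κ l)) := by ring
      _ ≤ _ := by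
          rw [mul_assoc D.lower⁻¹ (2 ^ (r + 1))]
          exact mul_le_mul_of_nonneg_left h2 (inv_pos.2 D.lower_pos).le
  · have hw := X.memLp.2.ne
    rw [bilinConst, ENNReal.coe_mul, ENNReal.coe_toNNReal (ENNReal.mul_ne_top (by norm_num) hw)]
    ring

theorem memLp_convWeighted (hs : 0 ≤ s) (hr : 0 ≤ r) (hrs : r ≤ s + 1) (U V : Lp ℂ 2 μ) :
    MemLp (X.convWeighted D s r U V) 2 μ := by
  refine ⟨X.aestronglyMeasurable_convWeighted D (Lp.aestronglyMeasurable U)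
    (Lp.aestronglyMeasurable V), (X.eLpNorm_convWeighted_le D hs hr hrs
      (Lp.stronglyMeasurable U).measurable (Lp.stronglyMeasurable V).measurable).trans_lt ?_⟩
  exact ENNReal.mul_lt_top ENNReal.coe_lt_top (ENNReal.mul_lt_top (Lp.memLp U).2 (Lp.memLp V).2)

/-- The bilinear operator `(u, v) ↦ Aⱼ(u v)` on weighted transforms. -/
noncomputable def bilin (hs : 0 ≤ s) (hr : 0 ≤ r) (hrs : r ≤ s + 1) :
    Lp ℂ 2 μ →L[ℂ] Lp ℂ 2 μ →L[ℂ] Lp ℂ 2 μ :=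
  LinearMap.mkContinuous₂
    (LinearMap.mk₂ ℂ (fun U V => (X.memLp_convWeighted D hs hr hrs U V).toLp)
      (fun U U' V => by
        rw [← MemLp.toLp_add]
        refine MemLp.toLp_congr _ _ (Eq.eventuallyEq ?_)
        rw [X.convWeighted_congr D (Lp.coeFn_add U U') (ae_eq_refl V), X.convWeighted_add_left D hs hr
          (Lp.memLp U) (Lp.memLp U') (Lp.memLp V)])
      (fun c U V => by
        rw [← MemLp.toLp_const_smul]
        refine MemLp.toLp_congr _ _ (Eq.eventuallyEq ?_)
        rw [X.convWeighted_congr D (Lp.coeFn_smul c U) (ae_eq_refl V), X.convWeighted_smul_left D])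
      (fun U V V' => by
        rw [← MemLp.toLp_add]
        refine MemLp.toLp_congr _ _ (Eq.eventuallyEq ?_)
        rw [X.convWeighted_congr D (ae_eq_refl U) (Lp.coeFn_add V V'),
          X.convWeighted_add_right D hs hr (Lp.memLp U) (Lp.memLp V) (Lp.memLp V')])
      (fun c U V => by
        rw [← MemLp.toLp_const_smul]
        refine MemLp.toLp_congr _ _ (Eq.eventuallyEq ?_)
        rw [X.convWeighted_congr D (ae_eq_refl U) (Lp.coeFn_smul c V),
          X.convWeighted_smul_right D]))
    (X.bilinConst D r)
    (fun U V => by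
      rw [LinearMap.mk₂_apply, Lp.norm_toLp, mul_assoc, Lp.norm_def, Lp.norm_def,
        ← ENNReal.toReal_mul]
      have hfin : eLpNorm U 2 μ * eLpNorm V 2 μ ≠ ⊤ :=
        ENNReal.mul_ne_top (Lp.memLp U).2.ne (Lp.memLp V).2.ne
      refine (ENNReal.toReal_mono (ENNReal.mul_ne_top ENNReal.coe_ne_top hfin)
        (X.eLpNorm_convWeighted_le D hs hr hrs (Lp.stronglyMeasurable U).measurable
          (Lp.stronglyMeasurable V).measurable)).trans_eq ?_
      rw [ENNReal.toReal_mul, ENNReal.coe_toReal])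

theorem coeFn_bilin (hs : 0 ≤ s) (hr : 0 ≤ r) (hrs : r ≤ s + 1) (U V : Lp ℂ 2 μ) :
    X.bilin D hs hr hrs U V =ᵐ[μ] X.convWeighted D s r U V :=
  (X.memLp_convWeighted D hs hr hrs U V).coeFn_toLp

omit [MeasurableAdd₂ G] [MeasurableNeg G] [SFinite μ] [μ.IsAddLeftInvariant]
  [μ.IsNegInvariant] in
theorem memLp_coeff : MemLp (fun k => D.coeff (X.κ k)) ∞ μ :=
  memLp_top_of_bound (D.measurable_coeff.comp X.measurable).aestronglyMeasurable D.lower⁻¹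
    (ae_of_all _ fun _ => D.norm_coeff_le_const _)

/-- The right-hand side `Aⱼ(w - γ (u w + w²))` on weighted transforms. -/
noncomputable def field (γ : ℝ) (hs : 0 ≤ s) (hr : 0 ≤ r) (hrs : r ≤ s + 1) (U W : Lp ℂ 2 μ) :
    Lp ℂ 2 μ :=
  mulL2 _ (X.memLp_coeff D) W -
    -- The square is the same bilinear operator with `s` replaced by `r`, as `r ≤ r + 1`.
    (γ : ℂ) • (X.bilin D hs hr hrs U W + X.bilin D hr hr (by linarith) W W)

/-- The weighted transform of `Aⱼ(w - γ (u w + w²))`. -/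
theorem coeFn_field (γ : ℝ) (hs : 0 ≤ s) (hr : 0 ≤ r) (hrs : r ≤ s + 1) (U W : Lp ℂ 2 μ) :
    X.field D γ hs hr hrs U W =ᵐ[μ] fun k => D.coeff (X.κ k) * X.wt r k *
      (X.wt (-r) k * W k - (γ : ℂ) *
        (fourierConv μ (fun l => X.wt (-s) l * U l) (fun l => X.wt (-r) l * W l) k +
          fourierConv μ (fun l => X.wt (-r) l * W l) (fun l => X.wt (-r) l * W l) k)) := by
  rw [field]
  filter_upwards [Lp.coeFn_sub (mulL2 _ (X.memLp_coeff D) W)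
      ((γ : ℂ) • (X.bilin D hs hr hrs U W + X.bilin D hr hr (by linarith) W W)),
    Lp.coeFn_smul (γ : ℂ) (X.bilin D hs hr hrs U W + X.bilin D hr hr (by linarith) W W),
    Lp.coeFn_add (X.bilin D hs hr hrs U W) (X.bilin D hr hr (by linarith) W W),
    coeFn_mulL2 _ (X.memLp_coeff D) W, X.coeFn_bilin D hs hr hrs U W,
    X.coeFn_bilin D hr hr (by linarith) W W] with k h1 h2 h3 h4 h5 h6
  have e : X.wt r k * X.wt (-r) k = 1 := by rw [wt_mul_wt, add_neg_cancel, wt_zero]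
  rw [h1, Pi.sub_apply, h2, Pi.smul_apply, h3, Pi.add_apply, h4, h5, h6, convWeighted,
    convWeighted, smul_eq_mul, mul_sub]
  congr 1
  · rw [mul_assoc, ← mul_assoc (X.wt r k), e, one_mul]
  · ring

end FrequencySpace

/-! ## Quadratic vector fields -/

theorem isLocallyLipschitzField_quadratic {E : Type*} [NormedAddCommGroup E] [NormedSpace ℂ E]
    (A : E →L[ℂ] E) (B₁ B₂ : E →L[ℂ] E →L[ℂ] E) (γ : ℂ) {T₀ : ℝ} {U : ℝ → E}
    (hU : ContinuousOn U (Icc (-T₀) T₀)) :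
    IsLocallyLipschitzField T₀ (fun t W => A W - γ • (B₁ (U t) W + B₂ W W)) where
  continuousOn := by
    have h1 : ContinuousOn (fun p : ℝ × E => U p.1) (Icc (-T₀) T₀ ×ˢ univ) :=
      hU.comp continuousOn_fst fun p hp => hp.1
    have h2 : ContinuousOn (fun p : ℝ × E => B₁ (U p.1)) (Icc (-T₀) T₀ ×ˢ univ) :=
      B₁.continuous.comp_continuousOn h1
    have h3 : ContinuousOn (fun p : ℝ × E => B₂ p.2) (Icc (-T₀) T₀ ×ˢ univ) :=
      B₂.continuous.comp_continuousOn continuousOn_snd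
    exact (A.continuous.comp_continuousOn continuousOn_snd).sub
      (((h2.clm_apply continuousOn_snd).add (h3.clm_apply continuousOn_snd)).const_smul γ)
  lipschitz R := by
    obtain ⟨M, hM⟩ := isCompact_Icc.exists_bound_of_continuousOn hU
    refine ⟨(‖A‖ + ‖γ‖ * (‖B₁‖ * M + (‖B₂‖ * R + ‖B₂‖ * R))).toNNReal, fun t ht =>
      LipschitzOnWith.of_dist_le_mul fun W hW W' hW' => ?_⟩
    rw [mem_closedBall_zero_iff] at hW hW'
    -- Every term of the difference contains the factor `W - W'`; symmetry of `B₂` is not needed.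
    have e : (A W - γ • (B₁ (U t) W + B₂ W W)) - (A W' - γ • (B₁ (U t) W' + B₂ W' W')) =
        A (W - W') - γ • (B₁ (U t) (W - W') + (B₂ (W - W') W + B₂ W' (W - W'))) := by
      simp only [map_sub, sub_apply, smul_add, smul_sub]
      abel
    rw [dist_eq_norm, dist_eq_norm, e]
    refine le_trans ?_ (mul_le_mul_of_nonneg_right (Real.le_coe_toNNReal _) (norm_nonneg _))
    have h1 := A.le_opNorm (W - W')
    have h2 : ‖B₁ (U t) (W - W')‖ ≤ ‖B₁‖ * M * ‖W - W'‖ :=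
      (B₁.le_opNorm₂ _ _).trans (by gcongr; exact hM t ht)
    have h3 : ‖B₂ (W - W') W‖ ≤ ‖B₂‖ * R * ‖W - W'‖ := by
      refine (B₂.le_opNorm₂ _ _).trans ?_
      rw [mul_right_comm]
      gcongr
    have h4 : ‖B₂ W' (W - W')‖ ≤ ‖B₂‖ * R * ‖W - W'‖ :=
      (B₂.le_opNorm₂ _ _).trans (by gcongr)
    calc _ ≤ ‖A (W - W')‖ + ‖γ • (B₁ (U t) (W - W') + (B₂ (W - W') W + B₂ W' (W - W')))‖ :=
          norm_sub_le _ _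
      _ ≤ ‖A (W - W')‖ + ‖γ‖ * (‖B₁ (U t) (W - W')‖ + (‖B₂ (W - W') W‖ + ‖B₂ W' (W - W')‖)) := by
          rw [norm_smul]
          gcongr
          exact (norm_add_le _ _).trans (by gcongr; exact norm_add_le _ _)
      _ ≤ ‖A‖ * ‖W - W'‖ + ‖γ‖ * (‖B₁‖ * M * ‖W - W'‖ +
            (‖B₂‖ * R * ‖W - W'‖ + ‖B₂‖ * R * ‖W - W'‖)) := by
          gcongr
      _ = _ := by ring

/-! ## Real-valued functions on the Fourier side -/

section ConjReflect

variable {G : Type*} [AddCommGroup G] [MeasurableSpace G] [MeasurableNeg G] {μ : Measure G}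
  [μ.IsNegInvariant]

/-- `W ↦ conj W(-·)`, the counterpart of complex conjugation. -/
noncomputable def conjReflect : Lp ℂ 2 μ →L[ℝ] Lp ℂ 2 μ :=
  (Complex.conjCLE : ℂ →L[ℝ] ℂ).compLpL 2 μ ∘L
    (Lp.compMeasurePreservingₗᵢ ℝ Neg.neg (Measure.measurePreserving_neg μ)).toContinuousLinearMap

theorem coeFn_conjReflect (W : Lp ℂ 2 μ) :
    conjReflect W =ᵐ[μ] fun k => (starRingEnd ℂ) (W (-k)) := by
  have h1 := (Complex.conjCLE : ℂ →L[ℝ] ℂ).coeFn_compLpL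
    (Lp.compMeasurePreservingₗᵢ ℝ Neg.neg (Measure.measurePreserving_neg μ) W)
  have h2 := Lp.coeFn_compMeasurePreserving W (Measure.measurePreserving_neg μ)
  filter_upwards [h1, h2] with k h1 h2
  refine h1.trans ?_
  have h3 : (Lp.compMeasurePreservingₗᵢ ℝ Neg.neg (Measure.measurePreserving_neg μ) W : Lp ℂ 2 μ) k
    = W (-k) := h2
  rw [h3]
  rfl

theorem conjReflect_eq_iff (W : Lp ℂ 2 μ) :
    conjReflect W = W ↔ ∀ᵐ k ∂μ, (starRingEnd ℂ) (W (-k)) = W k := by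
  rw [Lp.ext_iff]
  constructor
  · intro h
    filter_upwards [h, coeFn_conjReflect W] with k h1 h2
    rw [← h1, h2]
  · intro h
    filter_upwards [h, coeFn_conjReflect W] with k h1 h2
    rw [h2, h1]

theorem fourierConv_conj_neg (f g : G → ℂ) (k : G) :
    fourierConv μ (fun l => (starRingEnd ℂ) (f (-l))) (fun l => (starRingEnd ℂ) (g (-l))) k =
      (starRingEnd ℂ) (fourierConv μ f g (-k)) := by
  rw [fourierConv, fourierConv, ← integral_conj, ← integral_neg_eq_self _ μ]
  simp only [neg_neg, map_mul, neg_add', sub_eq_add_neg, add_comm]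

end ConjReflect

/-- Hermitian symmetry of the symbol: the multiplier maps real functions to real functions. -/
theorem DispersionSymbol.coeff_neg (D : DispersionSymbol) (x : ℝ) :
    D.coeff (-x) = (starRingEnd ℂ) (D.coeff x) := by
  simp [DispersionSymbol.coeff, D.even, neg_div]

namespace FrequencySpace

variable {G : Type*} [AddCommGroup G] [MeasurableSpace G] {μ : Measure G} (X : FrequencySpace μ)
  (D : DispersionSymbol)

theorem wt_neg (s : ℝ) (k : G) : X.wt s (-k) = X.wt s k := by
  rw [wt, wt, map_neg, sobolevWeight_neg_arg]

theorem conj_wt (s : ℝ) (k : G) : (starRingEnd ℂ) (X.wt s k) = X.wt s k := Complex.conj_ofReal _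

variable [MeasurableAdd₂ G] [MeasurableNeg G] [SFinite μ] [μ.IsAddLeftInvariant]
  [μ.IsNegInvariant] {s r : ℝ}

/-- The equation commutes with complex conjugation. -/
theorem conjReflect_field (γ : ℝ) (hs : 0 ≤ s) (hr : 0 ≤ r) (hrs : r ≤ s + 1) (U W : Lp ℂ 2 μ) :
    conjReflect (X.field D γ hs hr hrs U W) =
      X.field D γ hs hr hrs (conjReflect U) (conjReflect W) := by
  refine Lp.ext ?_
  have hneg := (Measure.measurePreserving_neg μ).quasiMeasurePreserving.ae_eq
    (X.coeFn_field D γ hs hr hrs U W)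
  have hW := coeFn_conjReflect W
  have e : ∀ (p : ℝ) (V : Lp ℂ 2 μ), (fun l => X.wt p l * conjReflect V l) =ᵐ[μ]
      fun l => (starRingEnd ℂ) (X.wt p (-l) * V (-l)) := by
    intro p V
    filter_upwards [coeFn_conjReflect V] with l hl
    rw [hl, map_mul, wt_neg, conj_wt]
  filter_upwards [coeFn_conjReflect (X.field D γ hs hr hrs U W), hneg, hW,
    X.coeFn_field D γ hs hr hrs (conjReflect U) (conjReflect W)] with k h1 h2 h3 h4
  simp only [Function.comp_apply] at h2
  rw [h1, h2, h4, fourierConv_congr (e _ U) (e _ W), fourierConv_congr (e _ W) (e _ W),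
    fourierConv_conj_neg (fun l => X.wt (-s) l * U l) (fun l => X.wt (-r) l * W l),
    fourierConv_conj_neg (fun l => X.wt (-r) l * W l) (fun l => X.wt (-r) l * W l), h3]
  simp only [map_mul, map_sub, map_add, map_neg, wt_neg, conj_wt, D.coeff_neg, Complex.conj_conj,
    Complex.conj_ofReal]

/-! ## Local Lipschitz continuity -/

theorem isLocallyLipschitzField (γ : ℝ) (hs : 0 ≤ s) (hr : 0 ≤ r) (hrs : r ≤ s + 1) {T₀ : ℝ}
    {U : ℝ → Lp ℂ 2 μ} (hU : ContinuousOn U (Icc (-T₀) T₀)) :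
    IsLocallyLipschitzField T₀ (fun t => X.field D γ hs hr hrs (U t)) :=
  isLocallyLipschitzField_quadratic _ _ _ (γ : ℂ) hU

/-- Solutions with real data are real. -/
theorem conjReflect_eq_of_isSolutionOn (γ : ℝ) (hs : 0 ≤ s) (hr : 0 ≤ r) (hrs : r ≤ s + 1)
    {T T₀ : ℝ} {U : ℝ → Lp ℂ 2 μ} (hU : ContinuousOn U (Icc (-T₀) T₀)) (hT : T ∈ Ioc 0 T₀)
    (hUr : ∀ t ∈ Icc (-T₀) T₀, conjReflect (U t) = U t) {W₀ : Lp ℂ 2 μ}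
    (hW₀ : conjReflect W₀ = W₀) {W : ℝ → Lp ℂ 2 μ}
    (hW : IsSolutionOn (fun t => X.field D γ hs hr hrs (U t)) T W₀ W) :
    ∀ t ∈ Icc (-T) T, conjReflect (W t) = W t := by
  have hsub : Icc (-T) T ⊆ Icc (-T₀) T₀ := Icc_subset_Icc (by linarith [hT.2]) hT.2
  -- For real `U` the conjugate solves the same Cauchy problem, and uniqueness identifies it with
  -- `W`.
  have h := hW.map (G := fun t => X.field D γ hs hr hrs (U t)) conjReflect fun t ht => by
    rw [conjReflect_field, hUr t (hsub ht)]
  rw [hW₀] at h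
  exact (X.isLocallyLipschitzField D γ hs hr hrs hU).eqOn hT h hW

end FrequencySpace

/-! ## The energy estimate -/

namespace FrequencySpace

open scoped ENNReal

variable {G : Type*} [AddCommGroup G] [MeasurableSpace G] {μ : Measure G} (X : FrequencySpace μ)
  (D : DispersionSymbol) [MeasurableAdd₂ G] [MeasurableNeg G] [SFinite μ] [μ.IsAddLeftInvariant]
  [μ.IsNegInvariant] {s r : ℝ}

omit [MeasurableAdd₂ G] [MeasurableNeg G] [SFinite μ] [μ.IsAddLeftInvariant]
  [μ.IsNegInvariant] in
/-- `‖f‖₁ < ∞` for `f ∈ H¹` on the Fourier side. -/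
theorem integrable_of_memLp_wt_one {f : G → ℂ} (hf : MemLp (fun k => X.wt 1 k * f k) 2 μ) :
    Integrable f μ := by
  have h := hf.integrable_mul (X.memLp.ofReal (K := ℂ))
  refine h.congr (ae_of_all _ fun k => ?_)
  have e : X.wt (-1) k * X.wt 1 k = 1 := by rw [wt_mul_wt, neg_add_cancel, wt_zero]
  change X.wt 1 k * f k * X.wt (-1) k = f k
  linear_combination f k * e

omit [SFinite μ] in
/-- The Leibniz rule. -/
theorem kappa_mul_fourierConv {f : G → ℂ} (hf : MemLp f 2 μ)
    (hg : MemLp (fun k => (X.κ k : ℂ) * f k) 2 μ) (k : G) :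
    (X.κ k : ℂ) * fourierConv μ f f k = 2 * fourierConv μ f (fun l => (X.κ l : ℂ) * f l) k := by
  have h1 := integrable_fourierConv hg hf k
  have h2 := integrable_fourierConv hf hg k
  calc (X.κ k : ℂ) * fourierConv μ f f k
      = ∫ l, (X.κ (k - l) : ℂ) * f (k - l) * f l + f (k - l) * ((X.κ l : ℂ) * f l) ∂μ := by
        rw [fourierConv, ← integral_const_mul]
        refine integral_congr_ae (ae_of_all _ fun l => ?_)
        simp only [map_sub, Complex.ofReal_sub]
        ring
    _ = fourierConv μ (fun l => (X.κ l : ℂ) * f l) f k +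
          fourierConv μ f (fun l => (X.κ l : ℂ) * f l) k := integral_add h1 h2
    _ = _ := by rw [fourierConv_comm (fun l => (X.κ l : ℂ) * f l) f, two_mul]

/-- The Fubini hypothesis for the cubic term: the inner convolution is bounded by `L²` norms, and
the outer integral converges because `f ∈ L¹`, which `H¹` regularity provides. -/
theorem integrable_trilinear {f g : G → ℂ} (hf : Measurable f) (hg : Measurable g)
    (hf1 : Integrable f μ) (hf2 : MemLp f 2 μ) (hg2 : MemLp g 2 μ) :
    Integrable (fun p : G × G => f (-p.1) * (f (p.1 - p.2) * g p.2)) (μ.prod μ) := by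
  refine ⟨Measurable.aestronglyMeasurable (by fun_prop), ?_⟩
  rw [hasFiniteIntegral_iff_enorm, lintegral_prod _ (by fun_prop)]
  have hfin : eLpNorm f 2 μ * eLpNorm g 2 μ < ∞ := ENNReal.mul_lt_top hf2.2 hg2.2
  calc ∫⁻ k, ∫⁻ l, ‖f (-k) * (f (k - l) * g l)‖ₑ ∂μ ∂μ
      ≤ ∫⁻ k, ‖f (-k)‖ₑ * (eLpNorm f 2 μ * eLpNorm g 2 μ) ∂μ := by
        refine lintegral_mono fun k => ?_
        simp only [enorm_mul]
        rw [lintegral_const_mul' _ _ enorm_ne_top]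
        gcongr
        have h := lintegral_conv_le (μ := μ) (f := fun l => ‖f l‖ₑ) (g := fun l => ‖g l‖ₑ)
          (by fun_prop) (by fun_prop) k
        have e : ∀ u : G → ℂ, eLpNorm (fun k => ‖u k‖ₑ) 2 μ = eLpNorm u 2 μ := fun u =>
          eLpNorm_enorm u
        rwa [e, e] at h
    _ = (∫⁻ k, ‖f k‖ₑ ∂μ) * (eLpNorm f 2 μ * eLpNorm g 2 μ) := by
        rw [lintegral_mul_const' _ _ hfin.ne, lintegral_neg_eq_self (fun k => ‖f k‖ₑ)]
    _ < ∞ := ENNReal.mul_lt_top hf1.2 hfin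

/-- `∫ w² w_x = 0`, on the Fourier side. -/
theorem integral_kappa_mul_fourierConv_eq_zero {f : G → ℂ} (hf : Measurable f)
    (hf2 : MemLp f 2 μ) (hg2 : MemLp (fun k => (X.κ k : ℂ) * f k) 2 μ) (hf1 : Integrable f μ) :
    ∫ k, f (-k) * ((X.κ k : ℂ) * fourierConv μ f f k) ∂μ = 0 := by
  have hg : Measurable fun k => (X.κ k : ℂ) * f k :=
    (Complex.measurable_ofReal.comp X.measurable).mul hf
  -- Let `I` be the integral. The Leibniz rule gives `I = 2 J`; exchanging the integrals and
  -- reflecting, with `κ` odd, gives `J = -I`. Hence `3 I = 0`.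
  have h1 : ∫ k, f (-k) * ((X.κ k : ℂ) * fourierConv μ f f k) ∂μ =
      2 * ∫ k, ∫ l, f (-k) * (f (k - l) * ((X.κ l : ℂ) * f l)) ∂μ ∂μ := by
    rw [← integral_const_mul]
    refine integral_congr_ae (ae_of_all _ fun k => ?_)
    simp only [integral_const_mul]
    rw [X.kappa_mul_fourierConv hf2 hg2, fourierConv]
    ring
  have h2 : ∫ k, ∫ l, f (-k) * (f (k - l) * ((X.κ l : ℂ) * f l)) ∂μ ∂μ =
      -∫ k, f (-k) * ((X.κ k : ℂ) * fourierConv μ f f k) ∂μ := by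
    rw [integral_integral_swap (integrable_trilinear hf hg hf1 hf2 hg2), ← integral_neg_eq_self _ μ,
      ← integral_neg]
    refine integral_congr_ae (ae_of_all _ fun l => ?_)
    have e : ∫ k, f (-k) * (f (k - -l) * ((X.κ (-l) : ℂ) * f (-l))) ∂μ =
        (∫ k, f (l - k) * f k ∂μ) * ((X.κ (-l) : ℂ) * f (-l)) := by
      rw [← integral_mul_const, ← integral_neg_eq_self _ μ]
      refine integral_congr_ae (ae_of_all _ fun k => ?_)
      simp only [neg_neg, sub_neg_eq_add, neg_add_eq_sub]
      ring
    refine e.trans ?_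
    simp only [fourierConv, map_neg, Complex.ofReal_neg]
    ring
  rw [h2] at h1
  have h3 : (3 : ℂ) * ∫ k, f (-k) * ((X.κ k : ℂ) * fourierConv μ f f k) ∂μ = 0 := by
    linear_combination h1
  exact (mul_eq_zero.1 h3).resolve_left (by norm_num)

/-- The square root of the energy density on weighted transforms. -/
noncomputable def energyWeight (r : ℝ) (k : G) : ℂ := ((√(D.m (X.κ k)) : ℝ) : ℂ) * X.wt (-r) k

omit [MeasurableAdd₂ G] [MeasurableNeg G] [SFinite μ] [μ.IsAddLeftInvariant]
  [μ.IsNegInvariant] in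
-- Since `√m` is at most of order 1 and `r ≥ 1`, the energy is finite on `H^r` and its square root
-- is the norm of a bounded operator applied to `W`.
theorem memLp_energyWeight (hr : 1 ≤ r) : MemLp (X.energyWeight D r) ∞ μ := by
  refine memLp_top_of_bound ?_ √D.upper (ae_of_all _ fun k => ?_)
  · exact ((Complex.measurable_ofReal.comp (D.measurable.sqrt.comp X.measurable)).mul
      (X.measurable_wt _)).aestronglyMeasurable
  · have h1 : √(D.m (X.κ k)) ≤ √D.upper * sobolevWeight 1 (X.κ k) := by
      have e : sobolevWeight 1 (X.κ k) = √(1 + X.κ k ^ 2) := by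
        rw [sobolevWeight, ← Real.sqrt_eq_rpow]
      rw [e, ← Real.sqrt_mul' _ (by positivity)]
      exact Real.sqrt_le_sqrt (D.le_upper _)
    rw [energyWeight, norm_mul, norm_wt, Complex.norm_real, Real.norm_of_nonneg (Real.sqrt_nonneg _)]
    calc _ ≤ √D.upper * sobolevWeight 1 (X.κ k) * sobolevWeight (-r) (X.κ k) :=
          mul_le_mul_of_nonneg_right h1 (sobolevWeight_pos _ _).le
      _ = √D.upper * sobolevWeight (1 + -r) (X.κ k) := by rw [sobolevWeight_add, mul_assoc]
      _ ≤ _ := mul_le_of_le_one_right (Real.sqrt_nonneg _) (sobolevWeight_le_one (by linarith) _)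

omit [MeasurableAdd₂ G] [MeasurableNeg G] [SFinite μ] [μ.IsAddLeftInvariant]
  [μ.IsNegInvariant] in
/-- The energy controls the `H¹` norm. -/
theorem eLpNorm_wt_le_energy (hr : 1 ≤ r) (W : Lp ℂ 2 μ) :
    eLpNorm (fun k => X.wt (1 - r) k * W k) 2 μ ≤
      ENNReal.ofReal (√D.lower)⁻¹ * ENNReal.ofReal ‖mulL2 _ (X.memLp_energyWeight D hr) W‖ := by
  rw [Lp.norm_def, ENNReal.ofReal_toReal (Lp.memLp _).2.ne]
  refine eLpNorm_le_mul_eLpNorm_of_ae_le_mul ?_ 2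
  filter_upwards [coeFn_mulL2 _ (X.memLp_energyWeight D hr) W] with k hk
  have hl := Real.sqrt_pos.2 D.lower_pos
  have h1 : √D.lower * sobolevWeight 1 (X.κ k) ≤ √(D.m (X.κ k)) := by
    have e : sobolevWeight 1 (X.κ k) = √(1 + X.κ k ^ 2) := by
      rw [sobolevWeight, ← Real.sqrt_eq_rpow]
    rw [e, ← Real.sqrt_mul' _ (by positivity)]
    exact Real.sqrt_le_sqrt (D.lower_le _)
  rw [hk, norm_mul, norm_mul, energyWeight, norm_mul, norm_wt, norm_wt, Complex.norm_real,
    Real.norm_of_nonneg (Real.sqrt_nonneg _), ← mul_assoc]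
  refine mul_le_mul_of_nonneg_right ?_ (norm_nonneg _)
  rw [← div_eq_inv_mul, le_div_iff₀ hl, sub_eq_add_neg, sobolevWeight_add]
  calc _ = √D.lower * sobolevWeight 1 (X.κ k) * sobolevWeight (-r) (X.κ k) := by ring
    _ ≤ _ := mul_le_mul_of_nonneg_right h1 (sobolevWeight_pos _ _).le

/-- The tame estimate for the quadratic term. -/
theorem exists_norm_bilin_self_le (hr : 1 ≤ r) :
    ∃ C : ℝ, 0 ≤ C ∧ ∀ W : Lp ℂ 2 μ,
      ‖X.bilin D (show 0 ≤ r by linarith) (show 0 ≤ r by linarith) (by linarith) W W‖ ≤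
        C * ‖mulL2 _ (X.memLp_energyWeight D hr) W‖ * ‖W‖ := by
  have hC : 0 ≤ D.lower⁻¹ * 2 ^ r :=
    mul_nonneg (inv_pos.2 D.lower_pos).le (Real.rpow_nonneg two_pos.le _)
  set N := eLpNorm (fun k => sobolevWeight (-1) (X.κ k)) 2 μ with hN
  refine ⟨D.lower⁻¹ * 2 ^ r * (2 * N.toReal) * (√D.lower)⁻¹, by positivity, fun W => ?_⟩
  have hwm := (continuous_sobolevWeight (-1)).measurable.comp X.measurable
  have hvm := (continuous_sobolevWeight (1 - r)).measurable.comp X.measurable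
  have hp := sobolevWeight_pos
  -- The weight `v` of order `1 - r` makes one factor the `H¹` norm, which the energy controls; the
  -- other stays in `H^r`.
  have h := eLpNorm_mul_fourierConv_self_le (μ := μ) (c := fun k => D.coeff (X.κ k) * X.wt r k)
    (p := X.wt (-r)) (q := X.wt (-r)) (w := fun k => sobolevWeight (-1) (X.κ k))
    (v := fun k => sobolevWeight (1 - r) (X.κ k)) (C := (D.lower⁻¹ * 2 ^ r).toNNReal)
    hwm (fun k => (hp _ _).le) hvm (fun k => (hp _ _).le) (Lp.stronglyMeasurable W).measurable
    (fun k l => by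
      rw [Real.coe_toNNReal _ hC, norm_wt, norm_wt]
      have h1 := X.norm_coeff_mul_wt_le D r (k + l)
      have h2 := sobolevWeight_tame_le hr (X.κ k) (X.κ l)
      rw [map_add] at h1
      rw [map_add]
      calc _ ≤ D.lower⁻¹ * sobolevWeight (r - 1) (X.κ k + X.κ l) * sobolevWeight (-r) (X.κ k) *
              sobolevWeight (-r) (X.κ l) := by
            have := (hp (-r) (X.κ k)).le
            have := (hp (-r) (X.κ l)).le
            gcongr
        _ = D.lower⁻¹ * (sobolevWeight (r - 1) (X.κ k + X.κ l) * sobolevWeight (-r) (X.κ k) *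
              sobolevWeight (-r) (X.κ l)) := by ring
        _ ≤ _ := by
            rw [mul_assoc D.lower⁻¹ (2 ^ r)]
            exact mul_le_mul_of_nonneg_left h2 (inv_pos.2 D.lower_pos).le)
  have h2 := X.eLpNorm_wt_le_energy D hr W
  rw [Lp.norm_def, eLpNorm_congr_ae (X.coeFn_bilin D _ _ _ W W)]
  have h3 : eLpNorm (X.convWeighted D r r W W) 2 μ ≤
      (D.lower⁻¹ * 2 ^ r).toNNReal * (2 * N * ENNReal.ofReal ‖W‖ * (ENNReal.ofReal (√D.lower)⁻¹ *
        ENNReal.ofReal ‖mulL2 _ (X.memLp_energyWeight D hr) W‖)) := by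
    refine h.trans ?_
    rw [Lp.norm_def W, ENNReal.ofReal_toReal (Lp.memLp W).2.ne]
    gcongr
    exact h2
  have hNf : N ≠ ∞ := X.memLp.2.ne
  refine (ENNReal.toReal_mono (by finiteness) h3).trans_eq ?_
  simp only [ENNReal.toReal_mul, ENNReal.coe_toReal, Real.coe_toNNReal _ hC,
    ENNReal.toReal_ofReal (norm_nonneg _), ENNReal.toReal_ofReal (inv_nonneg.2 (Real.sqrt_nonneg _)),
    ENNReal.toReal_ofNat]
  ring

end FrequencySpace

/-! ### Energy identity, energy estimate and a priori bound. -/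

namespace FrequencySpace

open scoped ENNReal InnerProductSpace

variable {G : Type*} [AddCommGroup G] [MeasurableSpace G] {μ : Measure G} (X : FrequencySpace μ)
  (D : DispersionSymbol) [MeasurableAdd₂ G] [MeasurableNeg G] [SFinite μ] [μ.IsAddLeftInvariant]
  [μ.IsNegInvariant] {s r : ℝ}

omit [MeasurableAdd₂ G] [MeasurableNeg G] [SFinite μ] [μ.IsAddLeftInvariant]
  [μ.IsNegInvariant] in
theorem norm_kappa_mul_le (z : ℂ) (k : G) : ‖(X.κ k : ℂ) * z‖ ≤ ‖X.wt 1 k * z‖ := by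
  rw [norm_mul, norm_mul, norm_wt, Complex.norm_real, Real.norm_eq_abs]
  exact mul_le_mul_of_nonneg_right (abs_le_sobolevWeight_one _) (norm_nonneg z)

/-- The product of an `L²` function and an `H¹` function is in `L²`; the energy estimate uses it for
`u w`, so only the `L²` norm of `u` enters. -/
theorem eLpNorm_fourierConv_le_wt {f g : G → ℂ} (hf : Measurable f) (hg : Measurable g) :
    eLpNorm (fourierConv μ g f) 2 μ ≤ eLpNorm (fun k => sobolevWeight (-1) (X.κ k)) 2 μ *
      eLpNorm g 2 μ * eLpNorm (fun k => X.wt 1 k * f k) 2 μ := by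
  refine (eLpNorm_fourierConv_le (w := fun k => sobolevWeight (-1) (X.κ k))
    ((continuous_sobolevWeight (-1)).measurable.comp X.measurable)
    (fun k => sobolevWeight_pos _ _) hg hf).trans_eq ?_
  congr 2
  funext k
  have e : X.wt (-1) k * X.wt 1 k = 1 := by rw [wt_mul_wt, neg_add_cancel, wt_zero]
  change (X.wt (-1) k)⁻¹ * f k = X.wt 1 k * f k
  rw [inv_eq_of_mul_eq_one_right e]

theorem memLp_fourierConv {f g : G → ℂ} (hf : Measurable f) (hg : Measurable g)
    (hg2 : MemLp g 2 μ) (hf2 : MemLp (fun k => X.wt 1 k * f k) 2 μ) :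
    MemLp (fourierConv μ g f) 2 μ :=
  ⟨aestronglyMeasurable_fourierConv hg.aestronglyMeasurable hf.aestronglyMeasurable,
    (X.eLpNorm_fourierConv_le_wt hf hg).trans_lt
      (ENNReal.mul_lt_top (ENNReal.mul_lt_top X.memLp.2 hg2.2) hf2.2)⟩

omit [AddCommGroup G] [MeasurableAdd₂ G] [MeasurableNeg G] [SFinite μ] [μ.IsAddLeftInvariant]
  [μ.IsNegInvariant] in
theorem norm_integral_conj_mul_le {f g : G → ℂ} (hf : MemLp f 2 μ) (hg : MemLp g 2 μ) :
    ‖∫ k, (starRingEnd ℂ) (f k) * g k ∂μ‖ ≤ (eLpNorm f 2 μ).toReal * (eLpNorm g 2 μ).toReal := by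
  have e : ∫ k, (starRingEnd ℂ) (f k) * g k ∂μ = ⟪hf.toLp, hg.toLp⟫_ℂ := by
    rw [L2.inner_def]
    refine integral_congr_ae ?_
    filter_upwards [hf.coeFn_toLp, hg.coeFn_toLp] with k h1 h2
    rw [h1, h2, RCLike.inner_apply, mul_comm]
  rw [e, ← Lp.norm_toLp f hf, ← Lp.norm_toLp g hg]
  exact norm_inner_le_norm _ _

/-- The energy identity: only the term with `u` contributes to the derivative of the energy. -/
theorem re_inner_energy_eq (γ : ℝ) (hs : 0 ≤ s) (hr : 1 ≤ r) (hrs : r ≤ s + 1) (U W : Lp ℂ 2 μ)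
    (hW : conjReflect W = W) :
    (⟪mulL2 _ (X.memLp_energyWeight D hr) W, mulL2 _ (X.memLp_energyWeight D hr)
      (X.field D γ hs (zero_le_one.trans hr) hrs U W)⟫_ℂ).re =
    (Complex.I * γ * ∫ k, (starRingEnd ℂ) ((X.κ k : ℂ) * (X.wt (-r) k * W k)) *
      fourierConv μ (fun l => X.wt (-s) l * U l) (fun l => X.wt (-r) l * W l) k ∂μ).re := by
  set f : G → ℂ := fun k => X.wt (-r) k * W k with hf
  set u : G → ℂ := fun k => X.wt (-s) k * U k with hu
  have hfm : Measurable f := (X.measurable_wt _).mul (Lp.stronglyMeasurable W).measurable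
  have hum : Measurable u := (X.measurable_wt _).mul (Lp.stronglyMeasurable U).measurable
  have hf2 : MemLp f 2 μ := X.memLp_wt_mul (by linarith) (Lp.memLp W)
  have hu2 : MemLp u 2 μ := X.memLp_wt_mul (by linarith) (Lp.memLp U)
  have hwf : MemLp (fun k => X.wt 1 k * f k) 2 μ := by
    have := X.memLp_wt_mul (s := 1 - r) (by linarith) (Lp.memLp W)
    refine this.congr_norm ((X.measurable_wt _).mul hfm).aestronglyMeasurable
      (ae_of_all _ fun k => ?_)
    rw [hf, ← mul_assoc, wt_mul_wt, sub_eq_add_neg]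
  have hκm : Measurable fun k => (X.κ k : ℂ) * f k :=
    (Complex.measurable_ofReal.comp X.measurable).mul hfm
  have hκf : MemLp (fun k => (X.κ k : ℂ) * f k) 2 μ :=
    hwf.mono hκm.aestronglyMeasurable (ae_of_all _ fun k => X.norm_kappa_mul_le (f k) k)
  -- Reality of `w`, which turns the cubic term into the vanishing trilinear integral.
  have hfneg : ∀ᵐ k ∂μ, (starRingEnd ℂ) (f k) = f (-k) := by
    filter_upwards [(conjReflect_eq_iff W).1 hW] with k hk
    simp only [hf]
    rw [map_mul, conj_wt, ← hk, Complex.conj_conj, wt_neg]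
  have hf1 : Integrable f μ := X.integrable_of_memLp_wt_one hwf
  have huf := X.memLp_fourierConv hfm hum hu2 hwf
  have hκff := X.memLp_fourierConv hfm hκm hκf hwf
  have i1 : Integrable (fun k => (starRingEnd ℂ) (f k) * ((X.κ k : ℂ) * f k)) μ :=
    hf2.star.integrable_mul hκf
  have i2 : Integrable (fun k => (starRingEnd ℂ) ((X.κ k : ℂ) * f k) * fourierConv μ u f k) μ :=
    hκf.star.integrable_mul huf
  have i3 : Integrable (fun k => f (-k) * ((X.κ k : ℂ) * fourierConv μ f f k)) μ := by
    have := (hf2.comp_measurePreserving (Measure.measurePreserving_neg μ)).integrable_mul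
      (hκff.const_mul 2)
    refine this.congr (ae_of_all _ fun k => ?_)
    have e := X.kappa_mul_fourierConv hf2 hκf k
    rw [fourierConv_comm f (fun l => (X.κ l : ℂ) * f l)] at e
    exact congrArg (f (-k) * ·) e.symm
  have key : ⟪mulL2 _ (X.memLp_energyWeight D hr) W, mulL2 _ (X.memLp_energyWeight D hr)
      (X.field D γ hs (zero_le_one.trans hr) hrs U W)⟫_ℂ =
      ∫ k, -Complex.I * ((starRingEnd ℂ) (f k) * ((X.κ k : ℂ) * f k)) +
        (Complex.I * γ * ((starRingEnd ℂ) ((X.κ k : ℂ) * f k) * fourierConv μ u f k) +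
        Complex.I * γ * (f (-k) * ((X.κ k : ℂ) * fourierConv μ f f k))) ∂μ := by
    rw [L2.inner_def]
    refine integral_congr_ae ?_
    filter_upwards [coeFn_mulL2 _ (X.memLp_energyWeight D hr) W,
      coeFn_mulL2 _ (X.memLp_energyWeight D hr) (X.field D γ hs (zero_le_one.trans hr) hrs U W),
      X.coeFn_field D γ hs (zero_le_one.trans hr) hrs U W, hfneg] with k h1 h2 h3 h4
    rw [h1, h2, h3, RCLike.inner_apply, ← h4, energyWeight]
    -- The reason for this energy: `m` cancels the denominator of the symbol and leaves the bare
    -- derivative.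
    have hm : (((√(D.m (X.κ k)) : ℝ) : ℂ)) * ((√(D.m (X.κ k)) : ℝ) : ℂ) * D.coeff (X.κ k) =
        -Complex.I * (X.κ k : ℂ) := by
      rw [← Complex.ofReal_mul, Real.mul_self_sqrt (D.m_pos _).le, DispersionSymbol.coeff]
      have : (D.m (X.κ k) : ℂ) ≠ 0 := by exact_mod_cast (D.m_pos _).ne'
      push_cast
      field_simp
    have hw : X.wt (-r) k * X.wt r k = 1 := by rw [wt_mul_wt, neg_add_cancel, wt_zero]
    simp only [hf, map_mul, conj_wt, Complex.conj_ofReal]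
    generalize fourierConv μ u (fun k => X.wt (-r) k * W k) k = p
    generalize fourierConv μ (fun k => X.wt (-r) k * W k) (fun k => X.wt (-r) k * W k) k = q
    linear_combination (X.wt (-r) k * (starRingEnd ℂ) (W k) *
      (X.wt (-r) k * W k - γ * (p + q))) * hm * (X.wt (-r) k * X.wt r k)
      + (-Complex.I * X.κ k * X.wt (-r) k * (starRingEnd ℂ) (W k) *
      (X.wt (-r) k * W k - γ * (p + q))) * hw
  have i23 : Integrable (fun k =>
      Complex.I * γ * ((starRingEnd ℂ) ((X.κ k : ℂ) * f k) * fourierConv μ u f k) +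
        Complex.I * γ * (f (-k) * ((X.κ k : ℂ) * fourierConv μ f f k))) μ :=
    (i2.const_mul _).add (i3.const_mul _)
  rw [key, integral_add (i1.const_mul _) i23, integral_add (i2.const_mul _) (i3.const_mul _), integral_const_mul, integral_const_mul,
    integral_const_mul, X.integral_kappa_mul_fourierConv_eq_zero hfm hf2 hκf hf1, mul_zero, add_zero,
    Complex.add_re]
  -- The linear term is `-i` times the real number `∫ κ |f|²`, so its real part vanishes.
  have hreal : ∫ k, (starRingEnd ℂ) (f k) * ((X.κ k : ℂ) * f k) ∂μ =
      ((∫ k, X.κ k * Complex.normSq (f k) ∂μ : ℝ) : ℂ) := by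
    refine Eq.trans ?_ integral_complex_ofReal
    refine integral_congr_ae (ae_of_all _ fun k => ?_)
    simp only [Complex.ofReal_mul, Complex.normSq_eq_conj_mul_self]
    ring
  have h0 : (-Complex.I * ∫ k, (starRingEnd ℂ) (f k) * ((X.κ k : ℂ) * f k) ∂μ).re = 0 := by
    rw [hreal]
    simp
  rw [h0, zero_add]

/-- The energy estimate. -/
theorem exists_re_inner_energy_le (γ : ℝ) (hs : 0 ≤ s) (hr : 1 ≤ r) (hrs : r ≤ s + 1) :
    ∃ C : ℝ, 0 ≤ C ∧ ∀ U W : Lp ℂ 2 μ, conjReflect W = W →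
      |(⟪mulL2 _ (X.memLp_energyWeight D hr) W, mulL2 _ (X.memLp_energyWeight D hr)
        (X.field D γ hs (zero_le_one.trans hr) hrs U W)⟫_ℂ).re| ≤
      C * ‖U‖ * ‖mulL2 _ (X.memLp_energyWeight D hr) W‖ ^ 2 := by
  set N := eLpNorm (fun k => sobolevWeight (-1) (X.κ k)) 2 μ with hN
  -- One factor `(√D.lower)⁻¹` comes from `‖κ f‖₂`, the other from the `H¹` norm in the bound of `u
  -- ⋆ f`; `N` is the norm of the weight in that bound.
  refine ⟨|γ| * N.toReal * (√D.lower)⁻¹ ^ 2, by positivity, fun U W hW => ?_⟩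
  rw [X.re_inner_energy_eq D γ hs hr hrs U W hW]
  set f : G → ℂ := fun k => X.wt (-r) k * W k with hf
  set u : G → ℂ := fun k => X.wt (-s) k * U k with hu
  set E := ‖mulL2 _ (X.memLp_energyWeight D hr) W‖ with hE
  have hfm : Measurable f := (X.measurable_wt _).mul (Lp.stronglyMeasurable W).measurable
  have hum : Measurable u := (X.measurable_wt _).mul (Lp.stronglyMeasurable U).measurable
  have hu2 : MemLp u 2 μ := X.memLp_wt_mul (by linarith) (Lp.memLp U)
  have ewf : (fun k => X.wt 1 k * f k) = fun k => X.wt (1 - r) k * W k := by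
    funext k
    rw [hf, ← mul_assoc, wt_mul_wt, sub_eq_add_neg]
  have hwf : MemLp (fun k => X.wt 1 k * f k) 2 μ := by
    rw [ewf]
    exact X.memLp_wt_mul (s := 1 - r) (by linarith) (Lp.memLp W)
  have hκm : Measurable fun k => (X.κ k : ℂ) * f k :=
    (Complex.measurable_ofReal.comp X.measurable).mul hfm
  have hκle : ∀ k, ‖(X.κ k : ℂ) * f k‖ ≤ ‖X.wt 1 k * f k‖ := fun k => X.norm_kappa_mul_le (f k) k
  have hκf : MemLp (fun k => (X.κ k : ℂ) * f k) 2 μ :=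
    hwf.mono hκm.aestronglyMeasurable (ae_of_all _ hκle)
  have b1 : eLpNorm (fun k => X.wt 1 k * f k) 2 μ ≤
      ENNReal.ofReal (√D.lower)⁻¹ * ENNReal.ofReal E := by
    rw [ewf]
    exact X.eLpNorm_wt_le_energy D hr W
  have hfin : ENNReal.ofReal (√D.lower)⁻¹ * ENNReal.ofReal E ≠ ∞ := by finiteness
  have hNf : N ≠ ∞ := X.memLp.2.ne
  have b2 : (eLpNorm (fun k => X.wt 1 k * f k) 2 μ).toReal ≤ (√D.lower)⁻¹ * E := by
    refine (ENNReal.toReal_mono hfin b1).trans_eq ?_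
    rw [ENNReal.toReal_mul, ENNReal.toReal_ofReal (inv_nonneg.2 (Real.sqrt_nonneg _)),
      ENNReal.toReal_ofReal (norm_nonneg _)]
  have b3 : (eLpNorm (fun k => (X.κ k : ℂ) * f k) 2 μ).toReal ≤ (√D.lower)⁻¹ * E :=
    (ENNReal.toReal_mono hwf.2.ne (eLpNorm_mono hκle)).trans b2
  have b4 : (eLpNorm u 2 μ).toReal ≤ ‖U‖ := by
    rw [Lp.norm_def]
    refine ENNReal.toReal_mono (Lp.memLp U).2.ne (eLpNorm_mono fun k => ?_)
    rw [hu, norm_mul, norm_wt]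
    exact mul_le_of_le_one_left (norm_nonneg _) (sobolevWeight_le_one (by linarith) _)
  have b5 : (eLpNorm (fourierConv μ u f) 2 μ).toReal ≤ N.toReal * ‖U‖ * ((√D.lower)⁻¹ * E) := by
    refine (ENNReal.toReal_mono (ENNReal.mul_ne_top (ENNReal.mul_ne_top hNf hu2.2.ne) hwf.2.ne)
      (X.eLpNorm_fourierConv_le_wt hfm hum)).trans ?_
    rw [ENNReal.toReal_mul, ENNReal.toReal_mul]
    gcongr
  refine (Complex.abs_re_le_norm _).trans ?_
  rw [norm_mul, norm_mul, Complex.norm_I, one_mul, Complex.norm_real, Real.norm_eq_abs]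
  calc _ ≤ |γ| * (((√D.lower)⁻¹ * E) * (N.toReal * ‖U‖ * ((√D.lower)⁻¹ * E))) := by
        gcongr
        refine (norm_integral_conj_mul_le hκf (X.memLp_fourierConv hfm hum hu2 hwf)).trans ?_
        gcongr
    _ = _ := by ring

/-- The a priori bound for real solutions in `H^r`, `r ≥ 1`. -/
theorem exists_apriori_bound (γ : ℝ) (hs : 0 ≤ s) (hr : 1 ≤ r) (hrs : r ≤ s + 1) {T₀ : ℝ}
    {U : ℝ → Lp ℂ 2 μ} (hU : ContinuousOn U (Icc (-T₀) T₀))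
    (hUr : ∀ t ∈ Icc (-T₀) T₀, conjReflect (U t) = U t) {W₀ : Lp ℂ 2 μ}
    (hW₀ : conjReflect W₀ = W₀) :
    ∃ R, ‖W₀‖ ≤ R ∧ ∀ T ∈ Ioc 0 T₀, ∀ W,
      IsSolutionOn (fun t => X.field D γ hs (zero_le_one.trans hr) hrs (U t)) T W₀ W →
        ∀ t ∈ Icc (-T) T, ‖W t‖ ≤ R := by
  obtain ⟨C₁, hC₁, henergy⟩ := X.exists_re_inner_energy_le D γ hs hr hrs
  obtain ⟨C₂, hC₂, htame⟩ := X.exists_norm_bilin_self_le D hr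
  obtain ⟨M, hM⟩ := isCompact_Icc.exists_bound_of_continuousOn hU
  set N := mulL2 _ (X.memLp_energyWeight D hr) with hN
  set A := mulL2 _ (X.memLp_coeff D) with hA
  set B := X.bilin D hs (zero_le_one.trans hr) hrs with hB
  set M' := max M 0 with hM'
  have hM0 : 0 ≤ M' := le_max_right _ _
  -- Grönwall bound for the energy, whose derivative is at most `2 C₁ M'` times itself. It involves
  -- `T₀` only, not the interval of the solution.
  set E := √(‖N W₀‖ ^ 2 * Real.exp (2 * C₁ * M' * T₀)) with hE
  -- Growth rate of `‖W‖` once the energy is bounded: the tame estimate makes even the quadratic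
  -- term linear in `‖W‖`.
  set K := ‖A‖ + |γ| * (‖B‖ * M' + C₂ * E) with hK
  have hK0 : 0 ≤ K := by positivity
  refine ⟨max ‖W₀‖ (‖W₀‖ * Real.exp (K * T₀)), le_max_left _ _, fun T hT W hW => ?_⟩
  have hsub : Icc (-T) T ⊆ Icc (-T₀) T₀ := Icc_subset_Icc (by linarith [hT.2]) hT.2
  have hMt : ∀ t ∈ Icc (-T) T, ‖U t‖ ≤ M' := fun t ht => (hM t (hsub ht)).trans (le_max_left _ _)
  have hreal := X.conjReflect_eq_of_isSolutionOn D γ hs (zero_le_one.trans hr) hrs hU hT hUr hW₀ hW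
  have henT : ∀ t ∈ Icc (-T) T, ‖N (W t)‖ ≤ E := by
    intro t ht
    have hderiv : ∀ t ∈ Icc (-T) T, HasDerivWithinAt (fun t => ‖N (W t)‖ ^ 2)
        (2 * (⟪N (W t), N (X.field D γ hs (zero_le_one.trans hr) hrs (U t) (W t))⟫_ℂ).re)
        (Icc (-T) T) t := by
      intro t ht
      have h1 := (N.restrictScalars ℝ).hasFDerivAt.comp_hasDerivWithinAt t (hW.hasDeriv t ht)
      have h2 := Complex.reCLM.hasFDerivAt.comp_hasDerivWithinAt t (h1.inner ℂ h1)
      refine (h2.congr_deriv ?_).congr_of_mem (fun t _ => ?_) ht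
      · simp only [Complex.reCLM_apply, Complex.add_re, ContinuousLinearMap.coe_restrictScalars']
        have := inner_re_symm (𝕜 := ℂ) (N (X.field D γ hs (zero_le_one.trans hr) hrs (U t) (W t)))
          (N (W t))
        simp only [RCLike.re_eq_complex_re] at this
        simp only [Function.comp_apply, this, two_mul]
      · exact (inner_self_eq_norm_sq (𝕜 := ℂ) (N (W t))).symm
    have h := norm_le_exp_of_norm_deriv_le (K := 2 * C₁ * M') hT.1.le (by positivity) hderiv
      (fun t ht => by
        rw [Real.norm_eq_abs, abs_mul, abs_two, Real.norm_of_nonneg (sq_nonneg _)]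
        have h3 := henergy (U t) (W t) (hreal t ht)
        have h4 : C₁ * ‖U t‖ * ‖N (W t)‖ ^ 2 ≤ C₁ * M' * ‖N (W t)‖ ^ 2 := by
          have := hMt t ht
          gcongr
        linarith) t ht
    rw [Real.norm_of_nonneg (sq_nonneg _), Real.norm_of_nonneg (sq_nonneg _), hW.initial] at h
    refine Real.le_sqrt_of_sq_le (h.trans ?_)
    have := hT.2
    gcongr
  intro t ht
  refine le_trans ?_ (le_max_right _ _)
  refine (norm_le_exp_of_norm_deriv_le (K := K) hT.1.le hK0 hW.hasDeriv (fun t ht => ?_) t ht).trans ?_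
  · have h1 := A.le_opNorm (W t)
    have h2 : ‖B (U t) (W t)‖ ≤ ‖B‖ * M' * ‖W t‖ := by
      have := hMt t ht
      exact (B.le_opNorm₂ _ _).trans (by gcongr)
    have h3 := (htame (W t)).trans (show _ ≤ C₂ * E * ‖W t‖ by have := henT t ht; gcongr)
    rw [field]
    refine (norm_sub_le _ _).trans ?_
    rw [norm_smul, Complex.norm_real, Real.norm_eq_abs]
    calc _ ≤ ‖A‖ * ‖W t‖ + |γ| * (‖B‖ * M' * ‖W t‖ + C₂ * E * ‖W t‖) := by
          gcongr
          exact (norm_add_le _ _).trans (add_le_add h2 h3)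
      _ = _ := by rw [hK]; ring
  · rw [hW.initial]
    have := hT.2
    gcongr

end FrequencySpace

/-! ## The Cauchy problem in a space isometric to `L²` of the frequencies -/

namespace FrequencySpace

open scoped ENNReal

variable {G : Type*} [AddCommGroup G] [MeasurableSpace G] {μ : Measure G} (X : FrequencySpace μ)
  (D : DispersionSymbol) [MeasurableAdd₂ G] [MeasurableNeg G] [SFinite μ] [μ.IsAddLeftInvariant]
  [μ.IsNegInvariant] {s r : ℝ}

/-- `Aⱼ(w - γ (u w + w²))`, where functions are given by weighted transforms. -/
noncomputable def pullbackField {Y Z : Type*} [NormedAddCommGroup Y] [NormedSpace ℂ Y]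
    [NormedAddCommGroup Z] [NormedSpace ℂ Z] (e : Y ≃ₗᵢ[ℂ] Lp ℂ 2 μ) (e' : Z ≃ₗᵢ[ℂ] Lp ℂ 2 μ)
    (γ : ℝ) (hs : 0 ≤ s) (hr : 0 ≤ r) (hrs : r ≤ s + 1) (u : ℝ → Z) (t : ℝ) (v : Y) : Y :=
  e.symm (X.field D γ hs hr hrs (e' (u t)) (e v))

/-- The abstract theorem behind both settings: the conclusions carry over through the isometries `e`
and `e'`, given that they translate reality into Hermitian symmetry. -/
theorem cauchyProblem {Y Z : Type*} [NormedAddCommGroup Y] [NormedSpace ℂ Y]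
    [NormedAddCommGroup Z] [NormedSpace ℂ Z] (e : Y ≃ₗᵢ[ℂ] Lp ℂ 2 μ) (e' : Z ≃ₗᵢ[ℂ] Lp ℂ 2 μ)
    {realY : Y → Prop} {realZ : Z → Prop} (hY : ∀ v, realY v ↔ conjReflect (e v) = e v)
    (hZ : ∀ v, realZ v ↔ conjReflect (e' v) = e' v) (γ : ℝ) (hs : 0 ≤ s) (hr : 0 ≤ r)
    (hrs : r ≤ s + 1) {T₀ : ℝ} (hT₀ : 0 < T₀) {u : ℝ → Z} (hu : ContinuousOn u (Icc (-T₀) T₀)) :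
    LocallyWellPosed T₀ (X.pullbackField D e e' γ hs hr hrs u) ∧
    ((∀ t ∈ Icc (-T₀) T₀, realZ (u t)) → ∀ w₀ : Y, realY w₀ →
      (∀ T ∈ Ioc 0 T₀, ∀ w : ℝ → Y, IsSolutionOn (X.pullbackField D e e' γ hs hr hrs u) T w₀ w →
        ∀ t ∈ Icc (-T) T, realY (w t)) ∧
      (1 ≤ r → ∃ w : ℝ → Y, IsSolutionOn (X.pullbackField D e e' γ hs hr hrs u) T₀ w₀ w ∧
        ∀ w' : ℝ → Y, IsSolutionOn (X.pullbackField D e e' γ hs hr hrs u) T₀ w₀ w' →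
          EqOn w' w (Icc (-T₀) T₀))) := by
  have hU : ContinuousOn (fun t => e' (u t)) (Icc (-T₀) T₀) := e'.continuous.comp_continuousOn hu
  have hfield := X.isLocallyLipschitzField D γ hs hr hrs hU
  have hF : IsLocallyLipschitzField T₀ (X.pullbackField D e e' γ hs hr hrs u) :=
    { continuousOn := e.symm.continuous.comp_continuousOn (hfield.continuousOn.comp
        (f := fun p : ℝ × Y => (p.1, e p.2)) (by fun_prop) fun p hp => ⟨hp.1, mem_univ _⟩)
      lipschitz := fun R => by
        obtain ⟨K, hK⟩ := hfield.lipschitz R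
        refine ⟨K, fun t ht => LipschitzOnWith.of_dist_le_mul fun v hv v' hv' => ?_⟩
        rw [mem_closedBall_zero_iff] at hv hv'
        rw [pullbackField, pullbackField, e.symm.dist_map, ← e.dist_map v v']
        exact (hK t ht).dist_le_mul _ (by simpa using hv) _ (by simpa using hv') }
  have : CompleteSpace Y := e.toIsometryEquiv.completeSpace_iff.2 inferInstance
  have hsol : ∀ {T : ℝ} {w₀ : Y} {w : ℝ → Y},
      IsSolutionOn (X.pullbackField D e e' γ hs hr hrs u) T w₀ w →
      IsSolutionOn (fun t => X.field D γ hs hr hrs (e' (u t))) T (e w₀) (fun t => e (w t)) :=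
    fun {T w₀ w} h => h.map
      ((e.toContinuousLinearEquiv : Y →L[ℂ] Lp ℂ 2 μ).restrictScalars ℝ) fun t _ => by
        change e (X.pullbackField D e e' γ hs hr hrs u t (w t)) = _
        rw [pullbackField, LinearIsometryEquiv.apply_symm_apply]
        rfl
  refine ⟨hF.locallyWellPosed hT₀, fun hur w₀ hw₀ => ?_⟩
  have hUr : ∀ t ∈ Icc (-T₀) T₀, conjReflect (e' (u t)) = e' (u t) := fun t ht => (hZ _).1 (hur t ht)
  have hW₀ := (hY _).1 hw₀
  refine ⟨fun T hT w hw t ht => (hY _).2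
    (X.conjReflect_eq_of_isSolutionOn D γ hs hr hrs hU hT hUr hW₀ (hsol hw) t ht), fun hr1 => ?_⟩
  obtain ⟨R, hR0, hR⟩ := X.exists_apriori_bound D γ hs hr1 hrs hU hUr hW₀
  obtain ⟨w, hw⟩ := hF.exists_global hT₀ w₀ R (by simpa using hR0) fun T hT w hw t ht => by
    simpa using hR T hT _ (hsol hw) t ht
  exact ⟨w, hw, fun w' hw' => hF.eqOn ⟨hT₀, le_rfl⟩ hw' hw⟩

end FrequencySpace

/-! ## The symbols `m₁` and `m₂` -/

theorem mul_coth_nonneg (y : ℝ) : 0 ≤ y * (Real.cosh y / Real.sinh y) := by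
  rw [← mul_div_assoc]
  rcases le_total 0 y with hy | hy
  · exact div_nonneg (mul_nonneg hy (Real.cosh_pos y).le) (Real.sinh_nonneg_iff.2 hy)
  · exact div_nonneg_of_nonpos (mul_nonpos_of_nonpos_of_nonneg hy (Real.cosh_pos y).le)
      (Real.sinh_nonpos_iff.2 hy)

/-- For `z > 0`, `cosh z ≤ sinh z + 1` and `z ≤ sinh z`. At `y = 0` the left side is 0 by the
convention on division. -/
theorem mul_coth_le (y : ℝ) : y * (Real.cosh y / Real.sinh y) ≤ 1 + |y| := by
  have key : ∀ z : ℝ, 0 < z → z * (Real.cosh z / Real.sinh z) ≤ 1 + z := by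
    intro z hz
    rw [← mul_div_assoc, div_le_iff₀ (Real.sinh_pos_iff.2 hz)]
    have h1 : Real.cosh z - Real.sinh z ≤ 1 := by
      rw [Real.cosh_sub_sinh]
      exact Real.exp_le_one_iff.2 (by linarith)
    have h2 : z ≤ Real.sinh z := Real.self_le_sinh_iff.2 hz.le
    nlinarith
  rcases lt_trichotomy y 0 with hy | rfl | hy
  · have := key (-y) (by linarith)
    rw [Real.cosh_neg, Real.sinh_neg, div_neg, neg_mul_neg] at this
    rwa [abs_of_neg hy]
  · simp
  · rw [abs_of_pos hy]
    exact key y hy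

theorem abs_le_one_add_sq (x : ℝ) : |x| ≤ 1 + x ^ 2 := by
  rw [← sq_abs]
  nlinarith [sq_nonneg (|x| - 1), abs_nonneg x]

/-- The symbol `mⱼ`. -/
noncomputable def dispersionSymbol (j : DispersionKind) {a b h : ℝ} (ha : 0 < a) (hb : 0 < b)
    (hh : 0 < h) : DispersionSymbol where
  m := symbolM j a b h
  measurable := by
    cases j
    · unfold symbolM
      fun_prop
    · unfold symbolM
      exact Measurable.ite (measurableSet_singleton 0) (by fun_prop) (by fun_prop)
  even x := by
    cases j
    · simp [symbolM]
    · by_cases hx : x = 0 <;> simp [symbolM, hx, div_neg]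
  lower := min 1 a
  -- From `x coth(hx) ≤ 1/h + |x|` and `|x| ≤ 1 + x²`. For the lower bound, the term with `b` is
  -- nonnegative and is dropped.
  upper := 1 + b / h + b + a
  lower_pos := lt_min one_pos ha
  lower_le x := by
    have h1 : min 1 a * (1 + x ^ 2) ≤ 1 + a * x ^ 2 := by
      have := mul_le_mul_of_nonneg_right (min_le_right 1 a) (sq_nonneg x)
      have := min_le_left 1 a
      linarith
    refine h1.trans ?_
    cases j
    · simp only [symbolM]
      have := mul_nonneg hb.le (abs_nonneg x)
      linarith
    · simp only [symbolM]
      split_ifs with hx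
      · rw [hx]
        have := div_pos hb hh
        simp [this.le]
      · have h2 := mul_coth_nonneg (h * x)
        rw [mul_assoc] at h2
        have := mul_nonneg hb.le (nonneg_of_mul_nonneg_right h2 hh)
        linarith
  le_upper x := by
    have hx1 := abs_le_one_add_sq x
    have hbh := div_pos hb hh
    have hx2 := sq_nonneg x
    have h3 := mul_le_mul_of_nonneg_left hx1 hb.le
    cases j
    · simp only [symbolM]
      nlinarith [mul_nonneg hbh.le hx2]
    · simp only [symbolM]
      split_ifs with hx
      · rw [hx]
        nlinarith
      · have h2 := mul_coth_le (h * x)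
        rw [abs_mul, abs_of_pos hh, mul_assoc] at h2
        have h4 : x * (Real.cosh (h * x) / Real.sinh (h * x)) ≤ 1 / h + |x| := by
          have e : 1 / h + |x| = (1 + h * |x|) / h := by field_simp
          rw [e, le_div_iff₀ hh]
          linarith
        have h5 := mul_le_mul_of_nonneg_left h4 hb.le
        have e2 : b * (1 / h + |x|) = b / h + b * |x| := by ring
        rw [e2] at h5
        nlinarith [mul_nonneg hbh.le hx2]

/-! ## The Fourier transform of a product on the line -/

section LineFourier

open scoped ENNReal SchwartzMap

/-- The theorem on transforms of convolutions, applied to `𝓕⁻ f` and `𝓕⁻ g` and read at `-ξ`. -/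
theorem SchwartzMap.fourier_mul_eq_fourierConv (f g : 𝓢(ℝ, ℂ)) (ξ : ℝ) :
    𝓕 (fun x => f x * g x) ξ = fourierConv volume (𝓕 f : 𝓢(ℝ, ℂ)) (𝓕 g : 𝓢(ℝ, ℂ)) ξ := by
  set B := ContinuousLinearMap.mul ℂ ℂ
  have h1 : (𝓕⁻ (SchwartzMap.pairing B f g) : 𝓢(ℝ, ℂ)) =
      SchwartzMap.convolution B (𝓕⁻ f) (𝓕⁻ g) := by
    have := SchwartzMap.fourier_convolution B (𝓕⁻ f) (𝓕⁻ g)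
    rw [FourierTransform.fourier_fourierInv_eq, FourierTransform.fourier_fourierInv_eq] at this
    rw [← this, FourierTransform.fourierInv_fourier_eq]
  have h2 := DFunLike.congr_fun h1 (-ξ)
  rw [SchwartzMap.convolution_apply, SchwartzMap.fourierInv_coe, Real.fourierInv_eq_fourier_neg,
    neg_neg] at h2
  refine Eq.trans ?_ (h2.trans ?_)
  · rfl
  · rw [convolution_def, ← integral_neg_eq_self]
    refine Eq.trans ?_ (integral_sub_left_eq_self
      (fun l => (𝓕 f : 𝓢(ℝ, ℂ)) (ξ - l) * (𝓕 g : 𝓢(ℝ, ℂ)) l) volume ξ)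
    refine integral_congr_ae (ae_of_all _ fun t => ?_)
    simp only [B, ContinuousLinearMap.mul_apply', SchwartzMap.fourierInv_coe, SchwartzMap.fourier_coe,
      Real.fourierInv_eq_fourier_neg, neg_neg, sub_sub_cancel, sub_neg_eq_add, neg_add, ← sub_eq_add_neg]

/-- At fixed `ξ` both sides are continuous on `L² × L²`, being pairings `∫ u v` composed with
bounded operators, and they agree on the dense Schwartz functions. -/
theorem MeasureTheory.Lp.fourier_mul_eq_fourierConv (f g : Lp ℂ 2 (volume : Measure ℝ)) (ξ : ℝ) :
    𝓕 (fun x => f x * g x) ξ = fourierConv volume (𝓕 f : Lp ℂ 2 (volume : Measure ℝ))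
      (𝓕 g : Lp ℂ 2 (volume : Measure ℝ)) ξ := by
  set P := (ContinuousLinearMap.mul ℂ ℂ).lpPairing (volume : Measure ℝ) 2 2 with hP
  have hPe : ∀ u v : Lp ℂ 2 (volume : Measure ℝ), P u v = ∫ x, u x * v x := fun u v =>
    (ContinuousLinearMap.mul ℂ ℂ).lpPairing_eq_integral u v
  set q : ℝ → ℂ := fun x => (Real.fourierChar (-(x * ξ)) : ℂ) with hq
  have hqm : MemLp q ∞ volume := by
    refine memLp_top_of_bound ?_ 1 (ae_of_all _ fun x => (Circle.norm_coe _).le)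
    have : Continuous q := continuous_induced_dom.comp (Real.continuous_fourierChar.comp (by fun_prop))
    exact this.aestronglyMeasurable
  have hmp := measurePreserving_const_sub (μ := (volume : Measure ℝ)) ξ
  have e1 : ∀ u v : Lp ℂ 2 (volume : Measure ℝ), 𝓕 (fun x => u x * v x) ξ = P (mulL2 q hqm u) v := by
    intro u v
    rw [hPe, Real.fourier_real_eq]
    refine integral_congr_ae ?_
    filter_upwards [coeFn_mulL2 q hqm u] with x hx
    rw [hx, Circle.smul_def, smul_eq_mul, mul_assoc]
  have e2 : ∀ u v : Lp ℂ 2 (volume : Measure ℝ), fourierConv volume u v ξ =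
      P (Lp.compMeasurePreserving _ hmp u) v := by
    intro u v
    rw [hPe]
    refine integral_congr_ae ?_
    filter_upwards [Lp.coeFn_compMeasurePreserving u hmp] with x hx
    rw [hx]
    rfl
  have hc1 : Continuous fun p : Lp ℂ 2 (volume : Measure ℝ) × Lp ℂ 2 (volume : Measure ℝ) =>
      𝓕 (fun x => p.1 x * p.2 x) ξ := by
    simp only [e1]
    fun_prop
  have hc2 : Continuous fun p : Lp ℂ 2 (volume : Measure ℝ) × Lp ℂ 2 (volume : Measure ℝ) =>
      fourierConv volume (𝓕 p.1 : Lp ℂ 2 (volume : Measure ℝ))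
        (𝓕 p.2 : Lp ℂ 2 (volume : Measure ℝ)) ξ := by
    simp only [e2]
    have h1 : Continuous fun u : Lp ℂ 2 (volume : Measure ℝ) => (𝓕 u : Lp ℂ 2 (volume : Measure ℝ)) :=
      (Lp.fourierTransformₗᵢ ℝ ℂ).continuous
    have h2 : Continuous fun u : Lp ℂ 2 (volume : Measure ℝ) => Lp.compMeasurePreserving _ hmp u :=
      (Lp.compMeasurePreservingₗᵢ ℂ _ hmp).continuous
    exact (P.continuous.comp (h2.comp (h1.comp continuous_fst))).clm_apply (h1.comp continuous_snd)
  have hd := SchwartzMap.denseRange_toLpCLM (E := ℝ) (F := ℂ) (p := 2) (μ := volume)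
    ENNReal.ofNat_ne_top
  refine hd.induction_on₂ (p := fun u v : Lp ℂ 2 (volume : Measure ℝ) =>
    𝓕 (fun x => u x * v x) ξ = fourierConv volume (𝓕 u : Lp ℂ 2 (volume : Measure ℝ))
      (𝓕 v : Lp ℂ 2 (volume : Measure ℝ)) ξ) (isClosed_eq hc1 hc2) (fun φ ψ => ?_) f g
  simp only [SchwartzMap.toLpCLM_apply]
  rw [SchwartzMap.toLp_fourier_eq, SchwartzMap.toLp_fourier_eq,
    fourierConv_congr ((𝓕 φ).coeFn_toLp 2) ((𝓕 ψ).coeFn_toLp 2),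
    ← SchwartzMap.fourier_mul_eq_fourierConv, Real.fourier_real_eq, Real.fourier_real_eq]
  refine integral_congr_ae ?_
  filter_upwards [φ.coeFn_toLp 2, ψ.coeFn_toLp 2] with x h1 h2
  rw [h1, h2]

/-- Complex conjugation on `L²`. -/
noncomputable def conjL2 {α : Type*} [MeasurableSpace α] (μ : Measure α) : Lp ℂ 2 μ →L[ℝ] Lp ℂ 2 μ :=
  (Complex.conjCLE : ℂ →L[ℝ] ℂ).compLpL 2 μ

theorem coeFn_conjL2 {α : Type*} [MeasurableSpace α] {μ : Measure α} (f : Lp ℂ 2 μ) :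
    conjL2 μ f =ᵐ[μ] fun x => (starRingEnd ℂ) (f x) :=
  (Complex.conjCLE : ℂ →L[ℝ] ℂ).coeFn_compLpL f

theorem conjL2_eq_iff {α : Type*} [MeasurableSpace α] {μ : Measure α} (f : Lp ℂ 2 μ) :
    conjL2 μ f = f ↔ ∀ᵐ x ∂μ, (f x).im = 0 := by
  rw [Lp.ext_iff]
  constructor
  · intro h
    filter_upwards [h, coeFn_conjL2 f] with x h1 h2
    rw [h2] at h1
    exact Complex.conj_eq_iff_im.1 h1
  · intro h
    filter_upwards [h, coeFn_conjL2 f] with x h1 h2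
    rw [h2]
    exact Complex.conj_eq_iff_im.2 h1

/-- Both sides are continuous in `f`, so Schwartz functions suffice, for which the Fourier integral
is conjugated directly. -/
theorem MeasureTheory.Lp.fourier_conjL2 (f : Lp ℂ 2 (volume : Measure ℝ)) :
    (𝓕 (conjL2 volume f) : Lp ℂ 2 (volume : Measure ℝ)) =
      conjReflect (𝓕 f : Lp ℂ 2 (volume : Measure ℝ)) := by
  have h1 : Continuous fun u : Lp ℂ 2 (volume : Measure ℝ) => (𝓕 u : Lp ℂ 2 (volume : Measure ℝ)) :=
    (Lp.fourierTransformₗᵢ ℝ ℂ).continuous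
  have hd := SchwartzMap.denseRange_toLpCLM (E := ℝ) (F := ℂ) (p := 2) (μ := volume)
    ENNReal.ofNat_ne_top
  refine hd.induction_on (p := fun u : Lp ℂ 2 (volume : Measure ℝ) =>
    (𝓕 (conjL2 volume u) : Lp ℂ 2 (volume : Measure ℝ)) =
      conjReflect (𝓕 u : Lp ℂ 2 (volume : Measure ℝ))) f
    (isClosed_eq (h1.comp (conjL2 volume).continuous) (conjReflect.continuous.comp h1)) fun φ => ?_
  set ψ : 𝓢(ℝ, ℂ) := SchwartzMap.postcompCLM (𝕜 := ℝ) (Complex.conjCLE : ℂ →L[ℝ] ℂ) φ with hψ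
  have e : conjL2 volume (φ.toLp 2) = ψ.toLp 2 := by
    refine Lp.ext ?_
    filter_upwards [coeFn_conjL2 (φ.toLp 2 volume), φ.coeFn_toLp 2, ψ.coeFn_toLp 2] with x h1 h2 h3
    rw [h1, h2, h3]
    rfl
  simp only [SchwartzMap.toLpCLM_apply]
  rw [e, SchwartzMap.toLp_fourier_eq, SchwartzMap.toLp_fourier_eq]
  refine Lp.ext ?_
  have hneg := (Measure.measurePreserving_neg (volume : Measure ℝ)).quasiMeasurePreserving.ae_eq
    ((𝓕 φ).coeFn_toLp 2)
  filter_upwards [(𝓕 ψ).coeFn_toLp 2, hneg, coeFn_conjReflect ((𝓕 φ).toLp 2 volume)] with ξ h2 h3 h4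
  simp only [Function.comp_apply] at h3
  rw [h2, h4, h3, SchwartzMap.fourier_coe, SchwartzMap.fourier_coe, Real.fourier_real_eq,
    Real.fourier_real_eq, ← integral_conj]
  refine integral_congr_ae (ae_of_all _ fun x => ?_)
  simp only [Circle.smul_def, smul_eq_mul, map_mul, mul_neg, neg_neg, ← Circle.coe_inv_eq_conj,
    ← AddChar.map_neg_eq_inv]
  rfl

end LineFourier

/-! ## The equation on the line -/

namespace LineH

open scoped ENNReal

/-- The frequencies of the line: the wave number is `2πξ`. -/
noncomputable def frequencySpace : FrequencySpace (volume : Measure ℝ) where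
  κ := AddMonoidHom.mulLeft (2 * Real.pi)
  measurable := by
    change Measurable fun x : ℝ => 2 * Real.pi * x
    fun_prop
  memLp := by
    refine (memLp_two_iff_integrable_sq ((continuous_sobolevWeight (-1)).comp
      (continuous_const_mul (2 * Real.pi))).aestronglyMeasurable).2 ?_
    have h := integrable_inv_one_add_sq.comp_mul_left' (R := 2 * Real.pi) (by positivity)
    refine h.congr (ae_of_all _ fun x => ?_)
    change (1 + (2 * Real.pi * x) ^ 2)⁻¹ = sobolevWeight (-1) (2 * Real.pi * x) ^ 2
    rw [sq (sobolevWeight _ _), ← sobolevWeight_add, sobolevWeight,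
      show ((-1 : ℝ) + -1) / 2 = -1 by norm_num, Real.rpow_neg_one]

theorem lineWeighted_eq (s : ℝ) (f : Lp ℂ 2 (volume : Measure ℝ)) :
    lineWeighted s f = fun ξ => frequencySpace.wt s ξ * (𝓕 f : Lp ℂ 2 (volume : Measure ℝ)) ξ := rfl

theorem coeFn_weighted {s : ℝ} (f : LineH s) : weighted f =ᵐ[volume] lineWeighted s (toL2 f) :=
  (memLp_weighted f).coeFn_toLp

theorem fourier_toL2 {s : ℝ} (f : LineH s) :
    (𝓕 (toL2 f) : Lp ℂ 2 (volume : Measure ℝ)) =ᵐ[volume]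
      fun ξ => frequencySpace.wt (-s) ξ * weighted f ξ := by
  filter_upwards [coeFn_weighted f] with ξ h
  rw [h, lineWeighted_eq, ← mul_assoc, FrequencySpace.wt_mul_wt, neg_add_cancel,
    FrequencySpace.wt_zero, one_mul]

/-- For `s ≥ 0` the inverse weight is bounded, so removing it from `g` gives the transform of an
actual `L²` function. -/
theorem weighted_surjective {s : ℝ} (hs : 0 ≤ s) : Function.Surjective (weighted (s := s)) := by
  intro g
  set g' := mulL2 _ (frequencySpace.memLp_wt_top (neg_nonpos.2 hs)) g with hg'
  set f : Lp ℂ 2 (volume : Measure ℝ) := 𝓕⁻ g' with hf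
  have h1 : (𝓕 f : Lp ℂ 2 (volume : Measure ℝ)) = g' := FourierTransform.fourier_fourierInv_eq g'
  have h2 : lineWeighted s f =ᵐ[volume] g := by
    rw [lineWeighted_eq, h1]
    filter_upwards [coeFn_mulL2 _ (frequencySpace.memLp_wt_top (neg_nonpos.2 hs)) g] with ξ h
    rw [h, ← mul_assoc, FrequencySpace.wt_mul_wt, add_neg_cancel, FrequencySpace.wt_zero, one_mul]
  have hmem : MemLp (lineWeighted s f) 2 volume := (memLp_congr_ae h2).2 (Lp.memLp g)
  exact ⟨(⟨f, hmem⟩ : lineSobolev s), Lp.ext (hmem.coeFn_toLp.trans h2)⟩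

/-- The weighted Fourier transform, as an isometry onto `L²`. -/
noncomputable def weightedEquiv {s : ℝ} (hs : 0 ≤ s) :
    LineH s ≃ₗᵢ[ℂ] Lp ℂ 2 (volume : Measure ℝ) :=
  LinearIsometryEquiv.ofSurjective ⟨weighted, fun _ => rfl⟩ (weighted_surjective hs)

/-- Hermitian symmetry of the transform survives the weight, which is real, even and nowhere zero.
-/
theorem isReal_iff {s : ℝ} (hs : 0 ≤ s) (f : LineH s) :
    f.IsReal ↔ conjReflect (weightedEquiv hs f) = weightedEquiv hs f := by
  have h1 : f.IsReal ↔ conjReflect (𝓕 (toL2 f) : Lp ℂ 2 (volume : Measure ℝ)) = 𝓕 (toL2 f) := by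
    rw [← Lp.fourier_conjL2, IsReal, ← conjL2_eq_iff]
    exact (Lp.fourierTransformₗᵢ ℝ ℂ).injective.eq_iff.symm
  rw [h1, conjReflect_eq_iff, conjReflect_eq_iff]
  change _ ↔ ∀ᵐ ξ : ℝ, (starRingEnd ℂ) (weighted f (-ξ)) = weighted f ξ
  have h2 := (Measure.measurePreserving_neg (volume : Measure ℝ)).quasiMeasurePreserving.ae_eq
    (fourier_toL2 f)
  refine eventually_congr ?_
  filter_upwards [fourier_toL2 f, h2] with ξ h3 h4
  simp only [Function.comp_apply] at h4
  rw [h3, h4, map_mul, FrequencySpace.wt_neg, FrequencySpace.conj_wt]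
  exact mul_right_inj' (frequencySpace.wt_ne_zero _ _)

/-- Identifies the abstract field with the concrete equation: the weights cancel and the
convolutions become transforms of products. -/
theorem isRHS_pullbackField (j : DispersionKind) {a b h α : ℝ} (ha : 0 < a) (hb : 0 < b)
    (hh : 0 < h) {s r : ℝ} (hs : 0 ≤ s) (hr : 0 ≤ r) (hrs : r ≤ s + 1) (u : ℝ → LineH s) (t : ℝ)
    (v : LineH r) :
    IsRHS j a b h α (u t) v (frequencySpace.pullbackField (dispersionSymbol j ha hb hh)
      (weightedEquiv hr) (weightedEquiv hs) (3 * α / 4) hs hr hrs u t v) := by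
  set D := dispersionSymbol j ha hb hh
  set g := frequencySpace.pullbackField D (weightedEquiv hr) (weightedEquiv hs) (3 * α / 4) hs hr
    hrs u t v with hg
  have hwg : weighted g = frequencySpace.field D (3 * α / 4) hs hr hrs (weighted (u t)) (weighted v) :=
    (weightedEquiv hr).apply_symm_apply _
  have hconv : ∀ ξ : ℝ, 𝓕 (fun x : ℝ => toL2 (u t) x * toL2 v x + toL2 v x ^ 2) ξ =
      fourierConv volume (fun l => frequencySpace.wt (-s) l * weighted (u t) l)
        (fun l => frequencySpace.wt (-r) l * weighted v l) ξ +
      fourierConv volume (fun l => frequencySpace.wt (-r) l * weighted v l)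
        (fun l => frequencySpace.wt (-r) l * weighted v l) ξ := by
    intro ξ
    rw [← fourierConv_congr (fourier_toL2 (u t)) (fourier_toL2 v),
      ← fourierConv_congr (fourier_toL2 v) (fourier_toL2 v), ← Lp.fourier_mul_eq_fourierConv,
      ← Lp.fourier_mul_eq_fourierConv, Real.fourier_real_eq, Real.fourier_real_eq,
      Real.fourier_real_eq]
    have hi : ∀ p q : Lp ℂ 2 (volume : Measure ℝ),
        Integrable (fun x => Real.fourierChar (-(x * ξ)) • (p x * q x)) := fun p q => by
      have h1 : Integrable fun x => p x * q x := (Lp.memLp p).integrable_mul (Lp.memLp q)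
      have h2 : Continuous fun x => Real.fourierChar (-(x * ξ)) :=
        Real.continuous_fourierChar.comp (by fun_prop)
      exact h1.congr' (h2.aestronglyMeasurable.smul h1.1)
        (ae_of_all _ fun x => (Circle.norm_smul _ _).symm)
    rw [← integral_add (hi _ _) (hi _ _)]
    simp only [sq, smul_add]
  have hfield := frequencySpace.coeFn_field D (3 * α / 4) hs hr hrs (weighted (u t)) (weighted v)
  rw [← hwg] at hfield
  filter_upwards [fourier_toL2 g, fourier_toL2 v, hfield] with ξ h1 h2 h3
  rw [h1, h2, h3, hconv]
  have e : frequencySpace.wt (-r) ξ * frequencySpace.wt r ξ = 1 := by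
    rw [FrequencySpace.wt_mul_wt, neg_add_cancel, FrequencySpace.wt_zero]
  have hD : D.coeff (frequencySpace.κ ξ) = -Complex.I * (symbolPhi j a b h (2 * Real.pi * ξ) : ℂ) := rfl
  rw [hD]
  linear_combination (-Complex.I * (symbolPhi j a b h (2 * Real.pi * ξ) : ℂ) *
    (frequencySpace.wt (-r) ξ * weighted v ξ - ((3 * α / 4 : ℝ) : ℂ) *
      (fourierConv volume (fun l => frequencySpace.wt (-s) l * weighted (u t) l)
        (fun l => frequencySpace.wt (-r) l * weighted v l) ξ +
      fourierConv volume (fun l => frequencySpace.wt (-r) l * weighted v l)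
        (fun l => frequencySpace.wt (-r) l * weighted v l) ξ))) * e

end LineH

/-! ## The equation on the circle -/

/-- Square summable families are the square integrable functions for the counting measure. -/
theorem memLp_count_iff_memℓp {ι : Type*} [MeasurableSpace ι] [MeasurableSingletonClass ι]
    [Countable ι] (f : ι → ℂ) : MemLp f 2 Measure.count ↔ Memℓp f 2 := by
  have hm : AEStronglyMeasurable f Measure.count :=
    (measurable_of_countable f).aestronglyMeasurable
  rw [memLp_two_iff_integrable_sq_norm hm, integrable_count_iff, memℓp_gen_iff (by norm_num)]
  simp

theorem norm_toLp_count {ι : Type*} [MeasurableSpace ι] [MeasurableSingletonClass ι]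
    [Countable ι] (f : lp (fun _ : ι => ℂ) 2) (hf : MemLp (f : ι → ℂ) 2 Measure.count) :
    ‖hf.toLp (f : ι → ℂ)‖ = ‖f‖ := by
  have hs : Integrable (fun i => ‖f i‖ ^ 2) Measure.count :=
    (memLp_two_iff_integrable_sq_norm hf.1).1 hf
  have h1 := lp.norm_rpow_eq_tsum (p := 2) (by norm_num) f
  simp only [ENNReal.toReal_ofNat, Real.rpow_ofNat] at h1
  have h2 : ∫ i, ‖f i‖ ^ 2 ∂Measure.count = ∑' i, ‖f i‖ ^ 2 := by
    rw [integral_countable hs]; simp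
  rw [Lp.norm_toLp, hf.eLpNorm_eq_integral_rpow_norm (by norm_num) (by norm_num)]
  simp only [ENNReal.toReal_ofNat, Real.rpow_ofNat]
  rw [h2, ← h1, ENNReal.toReal_ofReal (by positivity), ← Real.rpow_natCast,
    ← Real.rpow_mul (norm_nonneg _)]
  norm_num

namespace PerH

open scoped ENNReal

/-- The frequencies of the circle: the wave number is `k`. -/
noncomputable def frequencySpace : FrequencySpace (Measure.count : Measure ℤ) where
  κ := Int.castAddHom ℝ
  measurable := measurable_of_countable _
  memLp := by
    refine (memLp_two_iff_integrable_sq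
      (measurable_of_countable _).aestronglyMeasurable).2 (integrable_count_iff.2 ?_)
    refine (Real.summable_one_div_int_pow.2 one_lt_two).of_norm_bounded_eventually ?_
    -- The comparison with `1 / k²` fails only at `k = 0`, where division by zero makes the right
    -- side 0.
    filter_upwards [(Set.finite_singleton (0 : ℤ)).compl_mem_cofinite] with k hk
    have hk' : (0 : ℝ) < (k : ℝ) ^ 2 := by
      have : (k : ℝ) ≠ 0 := by exact_mod_cast hk
      positivity
    change ‖‖sobolevWeight (-1) (k : ℝ) ^ 2‖‖ ≤ 1 / (k : ℝ) ^ 2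
    rw [norm_norm, Real.norm_of_nonneg (sq_nonneg _), sq (sobolevWeight _ _), ← sobolevWeight_add,
      sobolevWeight, show ((-1 : ℝ) + -1) / 2 = -1 by norm_num, Real.rpow_neg_one, one_div]
    exact inv_anti₀ hk' (by linarith)

/-- Square summable families as square integrable functions. -/
noncomputable def countEquiv : lp (fun _ : ℤ => ℂ) 2 ≃ₗᵢ[ℂ] Lp ℂ 2 (Measure.count : Measure ℤ) :=
  LinearIsometryEquiv.ofSurjective
    { toFun := fun f => ((memLp_count_iff_memℓp _).2 f.2).toLp f
      map_add' := fun _ _ => rfl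
      map_smul' := fun _ _ => rfl
      norm_map' := fun f => norm_toLp_count f ((memLp_count_iff_memℓp _).2 f.2) }
    fun g => ⟨⟨(g : ℤ → ℂ), (memLp_count_iff_memℓp _).1 (Lp.memLp g)⟩, Lp.toLp_coeFn g (Lp.memLp g)⟩

theorem coeFn_countEquiv (f : lp (fun _ : ℤ => ℂ) 2) (k : ℤ) : countEquiv f k = f k := by
  exact Measure.ae_count_iff.1 ((memLp_count_iff_memℓp _).2 f.2).coeFn_toLp k

theorem perWeighted_eq (s : ℝ) (f : PerL2) (k : ℤ) :
    perWeighted s f k = frequencySpace.wt s k * fourierCoeff f k := rfl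

theorem weighted_surjective {s : ℝ} (hs : 0 ≤ s) : Function.Surjective (weighted (s := s)) := by
  intro g
  have hmem : Memℓp (fun k => frequencySpace.wt (-s) k * g k) 2 :=
    (memLp_count_iff_memℓp _).1 (frequencySpace.memLp_wt_mul (neg_nonpos.2 hs)
      ((memLp_count_iff_memℓp _).2 g.2))
  set f : PerL2 := fourierBasis.repr.symm ⟨_, hmem⟩ with hf
  have h1 : perWeighted s f = g := by
    funext k
    rw [perWeighted_eq, ← fourierBasis_repr, hf, LinearIsometryEquiv.apply_symm_apply]
    change frequencySpace.wt s k * (frequencySpace.wt (-s) k * g k) = g k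
    rw [← mul_assoc, FrequencySpace.wt_mul_wt, add_neg_cancel, FrequencySpace.wt_zero, one_mul]
  have hf2 : Memℓp (perWeighted s f) 2 := by rw [h1]; exact g.2
  exact ⟨(⟨f, hf2⟩ : perSobolev s), Subtype.ext h1⟩

/-- The weighted Fourier coefficients, as an isometry onto `L²` of the frequencies. -/
noncomputable def weightedEquiv {s : ℝ} (hs : 0 ≤ s) :
    PerH s ≃ₗᵢ[ℂ] Lp ℂ 2 (Measure.count : Measure ℤ) :=
  (LinearIsometryEquiv.ofSurjective ⟨weighted, fun _ => rfl⟩ (weighted_surjective hs)).trans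
    countEquiv

theorem fourierCoeff_toL2 {s : ℝ} (hs : 0 ≤ s) (f : PerH s) (k : ℤ) :
    fourierCoeff (toL2 f) k = frequencySpace.wt (-s) k * weightedEquiv hs f k := by
  have h : weightedEquiv hs f k = perWeighted s (toL2 f) k := coeFn_countEquiv (weighted f) k
  rw [h, perWeighted_eq, ← mul_assoc, FrequencySpace.wt_mul_wt, neg_add_cancel,
    FrequencySpace.wt_zero, one_mul]

end PerH

theorem fourierCoeff_conjL2 (f : PerL2) (k : ℤ) :
    fourierCoeff (conjL2 _ f) k = (starRingEnd ℂ) (fourierCoeff f (-k)) := by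
  rw [fourierCoeff, fourierCoeff, ← integral_conj]
  refine integral_congr_ae ?_
  filter_upwards [coeFn_conjL2 f] with x hx
  rw [hx]
  simp

/-- The Fourier coefficients of a product. -/
theorem fourierCoeff_mul_eq_fourierConv (p q : PerL2) (k : ℤ) :
    fourierCoeff (fun x => p x * q x) k =
      fourierConv Measure.count (fourierCoeff p) (fourierCoeff q) k := by
  have hc : ∀ f : PerL2, MemLp (fourierCoeff f) 2 Measure.count := fun f => by
    rw [← funext (fourierBasis_repr f), memLp_count_iff_memℓp]
    exact (fourierBasis.repr f).2
  have hR : MemLp (fun x => fourier (-k) x • p x) 2 AddCircle.haarAddCircle :=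
    (Lp.memLp p).congr_norm ((map_continuous (fourier (-k))).aestronglyMeasurable.smul (Lp.memLp p).1)
      (ae_of_all _ fun x => by rw [norm_smul, fourier_apply, Circle.norm_coe, one_mul])
  -- With `P = conj (e₋ₖ p)`, the coefficient of the product is `⟪P, q⟫`, and Parseval expands it
  -- because `⟪P, e_l⟫` is the coefficient of `p` at `k - l`.
  set P : PerL2 := conjL2 _ (hR.toLp _) with hP
  have h1 := fourierBasis.hasSum_inner_mul_inner P q
  have h2 : ∀ l, inner ℂ P (fourierBasis l) = fourierCoeff p (k - l) := fun l => by
    rw [← inner_conj_symm, ← fourierBasis.repr_apply_apply, fourierBasis_repr, hP,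
      fourierCoeff_conjL2, Complex.conj_conj, fourierCoeff_congr_ae hR.coeFn_toLp]
    refine integral_congr_ae (ae_of_all _ fun x => ?_)
    simp only [smul_eq_mul]
    rw [← mul_assoc, ← fourier_add]
    congr 3
    ring
  have h3 : inner ℂ P q = fourierCoeff (fun x => p x * q x) k := by
    rw [L2.inner_def]
    refine integral_congr_ae ?_
    filter_upwards [coeFn_conjL2 (hR.toLp _), hR.coeFn_toLp] with x h4 h5
    rw [RCLike.inner_apply', hP, h4, h5, Complex.conj_conj]
    simp only [smul_eq_mul, mul_assoc]
  simp only [h2, ← fourierBasis.repr_apply_apply, fourierBasis_repr] at h1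
  rw [← h3, ← h1.tsum_eq, fourierConv,
    integral_countable (integrable_fourierConv (hc p) (hc q) k)]
  simp

namespace PerH

theorem isReal_iff {s : ℝ} (hs : 0 ≤ s) (f : PerH s) :
    f.IsReal ↔ conjReflect (weightedEquiv hs f) = weightedEquiv hs f := by
  rw [conjReflect_eq_iff, Measure.ae_count_iff, IsReal, ← conjL2_eq_iff,
    ← fourierBasis.repr.injective.eq_iff, lp.ext_iff, funext_iff]
  refine forall_congr' fun k => ?_
  rw [fourierBasis_repr, fourierBasis_repr, fourierCoeff_conjL2, fourierCoeff_toL2 hs,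
    fourierCoeff_toL2 hs, map_mul, FrequencySpace.wt_neg, FrequencySpace.conj_wt]
  exact mul_right_inj' (frequencySpace.wt_ne_zero _ _)

theorem isRHS_pullbackField (j : DispersionKind) {a b h α : ℝ} (ha : 0 < a) (hb : 0 < b)
    (hh : 0 < h) {s r : ℝ} (hs : 0 ≤ s) (hr : 0 ≤ r) (hrs : r ≤ s + 1) (u : ℝ → PerH s) (t : ℝ)
    (v : PerH r) :
    IsRHS j a b h α (u t) v (frequencySpace.pullbackField (dispersionSymbol j ha hb hh)
      (weightedEquiv hr) (weightedEquiv hs) (3 * α / 4) hs hr hrs u t v) := by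
  intro k
  set D := dispersionSymbol j ha hb hh
  set g := frequencySpace.pullbackField D (weightedEquiv hr) (weightedEquiv hs) (3 * α / 4) hs hr
    hrs u t v with hg
  have hwg : weightedEquiv hr g = frequencySpace.field D (3 * α / 4) hs hr hrs
      (weightedEquiv hs (u t)) (weightedEquiv hr v) :=
    (weightedEquiv hr).apply_symm_apply _
  have hp : ∀ p q : PerL2, Integrable (fun x => p x * q x) AddCircle.haarAddCircle :=
    fun p q => (Lp.memLp p).integrable_mul (Lp.memLp q)
  have hsum : fourierCoeff (fun x => toL2 v x
        - ((3 * α / 4 : ℝ) : ℂ) * (toL2 (u t) x * toL2 v x + toL2 v x ^ 2)) k =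
      fourierCoeff (toL2 v) k - ((3 * α / 4 : ℝ) : ℂ) *
        (fourierCoeff (fun x => toL2 (u t) x * toL2 v x) k
          + fourierCoeff (fun x => toL2 v x * toL2 v x) k) := by
    have h1 := ((Lp.memLp (toL2 v)).integrable one_le_two).fourier_smul (-k)
    have h2 := (hp (toL2 (u t)) (toL2 v)).fourier_smul (-k)
    have h3 := (hp (toL2 v) (toL2 v)).fourier_smul (-k)
    simp only [fourierCoeff]
    rw [← integral_add h2 h3, ← integral_const_mul]
    refine Eq.trans ?_ (integral_sub h1 ((h2.add h3).const_mul _))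
    refine integral_congr_ae (ae_of_all _ fun x => ?_)
    simp only [smul_eq_mul]
    ring
  have hfield := Measure.ae_count_iff.1 (frequencySpace.coeFn_field D (3 * α / 4) hs hr hrs
    (weightedEquiv hs (u t)) (weightedEquiv hr v)) k
  have h1 : (fourierCoeff (toL2 v) : ℤ → ℂ) = fun l => frequencySpace.wt (-r) l *
    weightedEquiv hr v l := funext (fourierCoeff_toL2 hr v)
  have h2 : (fourierCoeff (toL2 (u t)) : ℤ → ℂ) = fun l => frequencySpace.wt (-s) l *
    weightedEquiv hs (u t) l := funext (fourierCoeff_toL2 hs (u t))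
  rw [hsum, fourierCoeff_toL2 hr g, hwg, hfield, fourierCoeff_mul_eq_fourierConv,
    fourierCoeff_mul_eq_fourierConv, h1, h2]
  have e : frequencySpace.wt (-r) k * frequencySpace.wt r k = 1 := by
    rw [FrequencySpace.wt_mul_wt, neg_add_cancel, FrequencySpace.wt_zero]
  have hD : D.coeff (frequencySpace.κ k) = -Complex.I * (symbolPhi j a b h (k : ℝ) : ℂ) := rfl
  beta_reduce
  rw [hD]
  linear_combination (-Complex.I * (symbolPhi j a b h (k : ℝ) : ℂ) *
    (frequencySpace.wt (-r) k * weightedEquiv hr v k - ((3 * α / 4 : ℝ) : ℂ) *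
      (fourierConv Measure.count (fun l => frequencySpace.wt (-s) l * weightedEquiv hs (u t) l)
        (fun l => frequencySpace.wt (-r) l * weightedEquiv hr v l) k +
      fourierConv Measure.count (fun l => frequencySpace.wt (-r) l * weightedEquiv hr v l)
        (fun l => frequencySpace.wt (-r) l * weightedEquiv hr v l) k))) * e

end PerH

/-! ### The theorem in both settings. -/

/-- The existential over `F` leaves no freedom on `[-T₀, T₀]`: `IsRHS` prescribes the transform of
`F t v`, hence `F t v` itself. -/
theorem mainTheorem4 (j : DispersionKind) (a b h α : ℝ)
    (ha : 0 < a) (hb : 0 < b) (hh : 0 < h) (hα : 0 < α)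
    (s r T₀ : ℝ) (hs : 0 ≤ s) (hr : 0 ≤ r) (hrs : r ≤ s + 1) (hT₀ : 0 < T₀) :
    -- nonperiodic setting
    (∀ u : ℝ → LineH s, ContinuousOn u (Icc (-T₀) T₀) →
      ∃ F : ℝ → LineH r → LineH r,
        (∀ t ∈ Icc (-T₀) T₀, ∀ v : LineH r, LineH.IsRHS j a b h α (u t) v (F t v)) ∧
        LocallyWellPosed T₀ F ∧
        ((∀ t ∈ Icc (-T₀) T₀, (u t).IsReal) → ∀ w₀ : LineH r, w₀.IsReal →
          (∀ T ∈ Ioc 0 T₀, ∀ w : ℝ → LineH r, IsSolutionOn F T w₀ w →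
            ∀ t ∈ Icc (-T) T, (w t).IsReal) ∧
          (1 ≤ r → ∃ w : ℝ → LineH r, IsSolutionOn F T₀ w₀ w ∧
            ∀ w' : ℝ → LineH r, IsSolutionOn F T₀ w₀ w' → EqOn w' w (Icc (-T₀) T₀)))) ∧
    -- periodic setting
    (∀ u : ℝ → PerH s, ContinuousOn u (Icc (-T₀) T₀) →
      ∃ F : ℝ → PerH r → PerH r,
        (∀ t ∈ Icc (-T₀) T₀, ∀ v : PerH r, PerH.IsRHS j a b h α (u t) v (F t v)) ∧
        LocallyWellPosed T₀ F ∧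
        ((∀ t ∈ Icc (-T₀) T₀, (u t).IsReal) → ∀ w₀ : PerH r, w₀.IsReal →
          (∀ T ∈ Ioc 0 T₀, ∀ w : ℝ → PerH r, IsSolutionOn F T w₀ w →
            ∀ t ∈ Icc (-T) T, (w t).IsReal) ∧
          (1 ≤ r → ∃ w : ℝ → PerH r, IsSolutionOn F T₀ w₀ w ∧
            ∀ w' : ℝ → PerH r, IsSolutionOn F T₀ w₀ w' → EqOn w' w (Icc (-T₀) T₀)))) := by
  refine ⟨fun u hu => ⟨LineH.frequencySpace.pullbackField (dispersionSymbol j ha hb hh)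
      (LineH.weightedEquiv hr) (LineH.weightedEquiv hs) (3 * α / 4) hs hr hrs u,
    fun t _ v => LineH.isRHS_pullbackField j ha hb hh hs hr hrs u t v,
    LineH.frequencySpace.cauchyProblem (dispersionSymbol j ha hb hh) (LineH.weightedEquiv hr)
      (LineH.weightedEquiv hs) (LineH.isReal_iff hr) (LineH.isReal_iff hs) (3 * α / 4) hs hr hrs
      hT₀ hu⟩, fun u hu => ⟨PerH.frequencySpace.pullbackField (dispersionSymbol j ha hb hh)
      (PerH.weightedEquiv hr) (PerH.weightedEquiv hs) (3 * α / 4) hs hr hrs u,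
    fun t _ v => PerH.isRHS_pullbackField j ha hb hh hs hr hrs u t v,
    PerH.frequencySpace.cauchyProblem (dispersionSymbol j ha hb hh) (PerH.weightedEquiv hr)
      (PerH.weightedEquiv hs) (PerH.isReal_iff hr) (PerH.isReal_iff hs) (3 * α / 4) hs hr hrs
      hT₀ hu⟩⟩
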